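/- An $[n,n-r]_2R$ code is a binary linear code (a linear subspace of $\mathbb F_2^n$) of length $n$, codimension $r$, and covering radius exactly $R$, where the covering radius of $C$ is $\max_{v\in\mathbb F_2^n}\min_{c\in C}d(v,c)$ for the Hamming distance $d$. The covering density of such a code is $\mu(C)=2^{-r}\sum_{i=0}^{R}\binom ni$; the asymptotic density $\overline\mu$ of an infinite family $U$ is $\liminf\mu(C)$ over $C\in U$ as the length of $C$ tends to infinity. The length function $\ell_2(r,R)$ is the smallest $n$ for which an $[n,n-r]_2R$ code exists. Let $t$ be an integer. **Theorem 2.1.** There are infinite families of binary linear covering codes of minimum distance $3$ with the following parameters, one code for each admissible $r$. (a) $R=2$: for $r=2t$ with $r\in\{10,18,20\}$ or $r\ge 28$, an $[n,n-r]_2 2$ code with $n=26\cdot 2^{t-4}-1$. The family has $\overline\mu=26^2/2^9\approx1.3203$. Hence $\ell_2(r,2)\le 26\cdot2^{r/2-4}-1$, which is smaller than the previously known bound $27\cdot2^{r/2-4}-1$ by $\Delta(r,2)=2^{r/2-4}$. (b) $R=3$: for $r=3t-1$ with $r=26$ or $r\ge 44$, an $[n,n-r]_2 3$ code with $n=819\cdot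 2^{t-9}-1$. The family has $\overline\mu=819^3/(3!\cdot2^{26})\approx1.3643$. Hence $\ell_2(r,3)\le 819\cdot2^{(r-26)/3}-1$, which is smaller than the previously known bound ($822\cdot 2^{(r-26)/3}-2=820$ for $r=26$, and $821\cdot2^{(r-26)/3}-1$ for $r\ge44$) by $\Delta(r,3)=2^{(r-23)/3}$. (c) $R=4$: for $r=4t$ with $r=40$ or $r\ge 68$, an $[n,n-r]_2 4$ code with $n=2943\cdot 2^{t-10}-1$. The family has $\overline\mu=2943^4/(4!\cdot2^{40})\approx2.8428$. Hence $\ell_2(r,4)\le 2943\cdot2^{r/4-10}-1$, and the previously known bound $2944\cdot2^{r/4-10}-2$ exceeds this by $\Delta(r,4)=2^{r/4-10}-1$ (which is $0$ for $r=40$). Each symbol $\approx$ means equality after rounding to four decimals. -/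

import Mathlib

open Filter

/-- The space of binary vectors of length `n`. -/
abbrev BinVec (n : ℕ) : Type := Fin n → ZMod 2

/-- A binary linear code: a length `n` together with a linear subspace of `𝔽₂ⁿ`. -/
abbrev BinCode : Type := Σ n : ℕ, Submodule (ZMod 2) (BinVec n)

namespace BinCode

/-- The length of a code. -/
def length (C : BinCode) : ℕ := C.1

/-- The dimension of a code over `𝔽₂`. -/
noncomputable def dim (C : BinCode) : ℕ := Module.finrank (ZMod 2) C.2

/-- The Hamming distance `d(v, C) = min_{c ∈ C} d(v, c)` (the minimum is over a nonempty set,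
as `0 ∈ C`). -/
noncomputable def distTo (C : BinCode) (v : BinVec C.1) : ℕ :=
  sInf {d : ℕ | ∃ c ∈ C.2, hammingDist v c = d}

/-- The covering radius `R(C) = max_v d(v, C)`, over all `v` in the ambient space. -/
noncomputable def coveringRadius (C : BinCode) : ℕ :=
  Finset.univ.sup fun v : BinVec C.1 => C.distTo v

/-- `C` has minimum distance `d`: this is the least Hamming distance between distinct codewords
(false for a code with only one codeword). -/
def HasMinDist (C : BinCode) (d : ℕ) : Prop :=
  IsLeast {e : ℕ | ∃ c ∈ C.2, ∃ c' ∈ C.2, c ≠ c' ∧ hammingDist c c' = e} d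

/-- `C` is an `[n, n - r]₂R` code: length `n`, codimension (redundancy) `r`, covering
radius `R`. -/
def IsCoveringCode (C : BinCode) (n r R : ℕ) : Prop :=
  C.length = n ∧ C.dim + r = n ∧ C.coveringRadius = R

/-- The covering density `2ᵏ V_{R,n} / 2ⁿ`, where `k` is the dimension, `n` the length, `R` the
covering radius of `C`, and `V_{R,n} = ∑_{i ≤ R} (n choose i)` is the volume of a Hamming ball. -/
noncomputable def density (C : BinCode) : ℝ :=
  2 ^ C.dim * (∑ i ∈ Finset.range (C.coveringRadius + 1), (C.length.choose i : ℝ)) / 2 ^ C.length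

end BinCode

/-- The length function `ℓ₂(r, R)`: the smallest length of a binary linear code of codimension `r`
and covering radius `R`. (The value at pairs for which there is no such code is `0`.) -/
noncomputable def lengthFunction (r R : ℕ) : ℕ :=
  sInf {n : ℕ | ∃ C : BinCode, C.IsCoveringCode n r R}

/-- The asymptotic covering density of a family `U` of codes: the lower limit of the covering
density of `C ∈ U` as the length of `C` tends to infinity. It is an extended real, equal to `⊤`
if the lengths of the codes in `U` are bounded. -/
noncomputable def asymptoticDensity (U : Set BinCode) : EReal :=
  liminf (fun C : BinCode => (C.density : EReal)) (comap BinCode.length atTop ⊓ 𝓟 U)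

/-- The bound on `ℓ₂(r, 2)` for even `r` known previously: `27 · 2^(r/2-4) - 1`. -/
def priorBound2 (r : ℕ) : ℤ := 27 * 2 ^ (r / 2 - 4) - 1

/-- The bound on `ℓ₂(r, 3)` for `r ≡ 2 (mod 3)`, `r ≥ 26`, known previously:
`822 · 2^((r-26)/3) - 2` for `r < 41`, and `821 · 2^((r-26)/3) - 1` for `r ≥ 41`. -/
def priorBound3 (r : ℕ) : ℤ :=
  if r < 41 then 822 * 2 ^ ((r - 26) / 3) - 2 else 821 * 2 ^ ((r - 26) / 3) - 1

/-- The bound on `ℓ₂(r, 4)` for `4 ∣ r`, `r ≥ 40`, known previously: `2944 · 2^(r/4-10) - 2`. -/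
def priorBound4 (r : ℕ) : ℤ := 2944 * 2 ^ (r / 4 - 10) - 2

/-- The values `t` for which `r = 2t` is `10`, `18`, `20` or at least `28`. -/
def index2 : Set ℕ :=
  {t | ∃ r, r = 2 * t ∧ (r = 10 ∨ r = 18 ∨ r = 20 ∨ 28 ≤ r)}

/-- The values `t` for which `r = 3t - 1` is `26` or at least `44`. -/
def index3 : Set ℕ :=
  {t | ∃ r, r + 1 = 3 * t ∧ (r = 26 ∨ 44 ≤ r)}

/-- The values `t` for which `r = 4t` is `40` or at least `68`. -/
def index4 : Set ℕ :=
  {t | ∃ r, r = 4 * t ∧ (r = 40 ∨ 68 ≤ r)}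

/-!
A family of columns `h i` in a space `V` over the field with two elements is a parity-check matrix
of a code; its covering radius is at most `R` when every vector of `V` is a sum of at most `R`
columns (`Covers`), and its minimum distance is `3` when the columns are distinct and nonzero and
some column is the sum of two others (`IsDistanceThree`). All codes here are given in this form.
The sphere-covering bound makes the covering radius equal to `R` (`isCoveringCode_columnCode`).

The families arise by lengthening a short code. Let `K` be the field with `2 ^ m` elements and
colour the columns by elements `κ i` of `K`. The columns `(h i, ξ, κ i * ξ, …, κ i ^ (R - 1) * ξ)`,
for all `i` and all `ξ` in `K`, together with `2 ^ m - 1` columns that fill one further direction,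
turn length `n` and codimension `r` into `(n + 1) * 2 ^ m - 1` and `r + R * m`, which leaves
`(n + 1) ^ R / 2 ^ r`, and with it the asymptotic density, unchanged. If a vector of `V` is a sum
of `R` columns of pairwise distinct colours (`ColouredCovers`), a Vandermonde system in the `ξ`
prescribes the `R` new coordinates. A sum of `R - 1` columns of distinct colours also suffices,
with an added column that completes the points `(1, κ, …, κ ^ (R - 1))` in use to a basis: the
added direction is the point at infinity of a normal rational curve for `R = 2, 4`
(`colouredCovers_liftTwo`, `covers_liftFour`) and the nucleus of a conic for `R = 3`
(`covers_liftThree`).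

* For `R = 2` a short code is a `[51, 41]` code with a colouring by `16` colours. Shorter sums occur
  here, so all elements of `K` must be colours, but the longer code can be coloured again, by
  `2 ^ (m + 1)` colours, and lengthening can be iterated (`HasTwoColumns.lift`,
  `hasTwoColumns_family`). The exceptional values of `r` are those the iteration does not reach.
* For `R = 3` the short code is an `[818, 792]` code (`hasColumns_818`). Each of the `23` columns
  `g i` of the perfect binary Golay code gets its own nonzero label `β i` in the field with `32`
  elements and is replaced by the `32` columns `(g i, ξ, β i * ξ, β i ^ 2 * ξ)`; the nonzero
  elements are added in the first coordinate over this field, and the columns of the `[51, 41]`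
  code in the other two. Where a single column over `i` would do, which is too short a sum for the
  next lengthening, it is replaced by a sum of three that contains a column of the `[51, 41]` code
  proportional to `(β i, β i ^ 2)`. That code has such columns for `23` values of `β i`
  (`powerColumns`), and these are the labels.
* For `R = 4` the short code is a `[2942, 2902]` code (`hasColumns_2942`), obtained from a
  `[90, 70]` code, in which sums of two columns of distinct colours have to be allowed as well, by
  lengthening over the field with `32` elements with two added directions. In characteristic `2`
  these can be chosen independent of any two points of the twisted cubic.

The three coloured covers of the short codes of length `51`, `23` and `90` are verified by a
computation on bit masks (`colouredCovers_of_isFull`): the set of sums of `k` columns with distinct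
colours is kept as one natural number, and translation by a column is a few shifts.
-/

/-! ### Column systems and coloured covers -/

/-- Every vector of `V` is the sum of at most `R` (not necessarily distinct) columns `h i`: as a
parity-check matrix, `h` has covering radius at most `R`. -/
def Covers {ι V : Type*} [AddCommMonoid V] (h : ι → V) (R : ℕ) : Prop :=
  ∀ v, ∃ l : List ι, l.length ≤ R ∧ (l.map h).sum = v

/-- Every vector of `V`, the zero vector included, is the sum of at least `ℓ` and at most `R`
columns `h i` with pairwise distinct colours `κ i`. -/
def ColouredCovers {ι V C : Type*} [AddCommMonoid V] (h : ι → V) (κ : ι → C) (ℓ R : ℕ) : Prop :=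
  ∀ v, ∃ l : List ι, ℓ ≤ l.length ∧ l.length ≤ R ∧ (l.map κ).Nodup ∧ (l.map h).sum = v

lemma ColouredCovers.covers {ι V C : Type*} [AddCommMonoid V] {h : ι → V} {κ : ι → C} {ℓ R : ℕ}
    (H : ColouredCovers h κ ℓ R) : Covers h R := fun v => by
  obtain ⟨l, -, h2, -, h4⟩ := H v
  exact ⟨l, h2, h4⟩

/-- A colouring that separates more columns still gives a coloured cover. -/
lemma ColouredCovers.refine {ι V C C' : Type*} [AddCommMonoid V] {h : ι → V} {κ : ι → C}
    {κ' : ι → C'} {ℓ R : ℕ} (H : ColouredCovers h κ ℓ R)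
    (hκ : ∀ i j, κ' i = κ' j → κ i = κ j) : ColouredCovers h κ' ℓ R := fun v => by
  obtain ⟨l, h1, h2, h3, h4⟩ := H v
  refine ⟨l, h1, h2, ?_, h4⟩
  have h5 : l.Pairwise fun i j => κ i ≠ κ j := by simpa [List.Nodup, List.pairwise_map] using h3
  rw [List.Nodup, List.pairwise_map]
  exact h5.imp fun hne he => hne (hκ _ _ he)

/-! ### Binary vectors as natural numbers -/

/-- The binary expansion of `n`, cut off after `r` digits. -/
def bitVec (r n : ℕ) : BinVec r := fun i => if n.testBit i then 1 else 0

lemma bitVec_xor (r a b : ℕ) : bitVec r (a ^^^ b) = bitVec r a + bitVec r b := by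
  funext i
  simp only [bitVec, Pi.add_apply, Nat.testBit_xor]
  cases a.testBit i <;> cases b.testBit i <;> decide

lemma bitVec_zero (r : ℕ) : bitVec r 0 = 0 := by
  funext i
  simp [bitVec]

lemma bitVec_inj {r a b : ℕ} (ha : a < 2 ^ r) (hb : b < 2 ^ r) (h : bitVec r a = bitVec r b) :
    a = b := by
  refine Nat.eq_of_testBit_eq fun i => ?_
  by_cases hi : i < r
  · have := congrFun h ⟨i, hi⟩
    simp only [bitVec] at this
    cases h1 : a.testBit i <;> cases h2 : b.testBit i <;> simp_all
  · have hle : 2 ^ r ≤ 2 ^ i := Nat.pow_le_pow_right (by norm_num) (by omega)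
    rw [Nat.testBit_lt_two_pow (ha.trans_le hle), Nat.testBit_lt_two_pow (hb.trans_le hle)]

lemma exists_bitVec_eq {r : ℕ} (v : BinVec r) : ∃ n < 2 ^ r, bitVec r n = v := by
  have hinj : Function.Injective fun n : Fin (2 ^ r) => bitVec r n := fun a b h =>
    Fin.ext (bitVec_inj a.2 b.2 h)
  have := (Fintype.bijective_iff_injective_and_card (fun n : Fin (2 ^ r) => bitVec r n)).2
    ⟨hinj, by simp [ZMod.card]⟩
  obtain ⟨n, hn⟩ := this.2 v
  exact ⟨n, n.2, hn⟩

lemma bitVec_foldr_xor (r : ℕ) (l : List ℕ) :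
    bitVec r (l.foldr (· ^^^ ·) 0) = (l.map (bitVec r)).sum := by
  induction l with
  | nil => simp [bitVec_zero]
  | cons a l ih => simp [bitVec_xor, ih]

/-! ### A checkable certificate for coloured covers -/

/-- A bit mask containing only positions whose binary digit number `b` is `0`. -/
def lowMask (b : ℕ) : ℕ → ℕ
  | 0 => 2 ^ 2 ^ b - 1
  | k + 1 => lowMask b k ||| (lowMask b k <<< 2 ^ (b + 1 + k))

/-- Apply `n ↦ n ^^^ 2 ^ b` to the set of natural numbers `< 2 ^ r` with bit mask `m`. -/
def flipBit (r m b : ℕ) : ℕ :=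
  ((m >>> 2 ^ b) &&& lowMask b (r - b - 1)) ||| ((m &&& lowMask b (r - b - 1)) <<< 2 ^ b)

/-- Apply `n ↦ n ^^^ d` to the set with bit mask `m`, digit by digit; the last argument is the
number of digits of `d` that are used. -/
def xorShift (r m d : ℕ) : ℕ → ℕ
  | 0 => m
  | b + 1 => bif d.testBit b then flipBit r (xorShift r m d b) b else xorShift r m d b

/-- Given bit masks of the sets of sums of `0, 1, 2, …` columns, allow one further column from
the list `C`. -/
def addClass (r : ℕ) (C : List ℕ) : ℕ → List ℕ → List ℕ
  | _, [] => []
  | prev, m :: ms => C.foldl (fun acc g => acc ||| xorShift r prev g r) m :: addClass r C m ms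

/-- Bit masks of the sets of sums of `0, 1, …, R` columns, at most one from each of the given
lists. -/
def rainbowSums (r R : ℕ) : List (List ℕ) → List ℕ
  | [] => 1 :: List.replicate R 0
  | C :: cs => addClass r C 0 (rainbowSums r R cs)

/-- The test that all numbers `< 2 ^ r` are sums of at least `ℓ` and at most `R` columns from
distinct lists. -/
def isFull (r ℓ R : ℕ) (cs : List (List ℕ)) : Bool :=
  ((rainbowSums r R cs).drop ℓ).foldr (· ||| ·) 0 == 2 ^ 2 ^ r - 1

/-- The columns in the given lists, each paired with a number that identifies its list. -/
def colouredColumns : List (List ℕ) → List (ℕ × ℕ)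
  | [] => []
  | C :: cs => C.map (Prod.mk cs.length) ++ colouredColumns cs

lemma testBit_lowMask {b k n : ℕ} (h : (lowMask b k).testBit n = true) : n.testBit b = false := by
  induction k generalizing n with
  | zero =>
    simp only [lowMask, Nat.testBit_two_pow_sub_one, decide_eq_true_eq] at h
    exact Nat.testBit_lt_two_pow h
  | succ k ih =>
    simp only [lowMask, Nat.testBit_or, Nat.testBit_shiftLeft, Bool.or_eq_true, Bool.and_eq_true,
      decide_eq_true_eq] at h
    rcases h with h | ⟨h1, h2⟩
    · exact ih h
    · have := ih h2
      rw [← Nat.testBit_two_pow_add_gt (show b < b + 1 + k by omega)] at this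
      rwa [Nat.add_sub_cancel' h1] at this

lemma two_pow_add_eq_xor {n b : ℕ} (h : n.testBit b = false) : 2 ^ b + n = n ^^^ 2 ^ b := by
  have hr : n % 2 ^ b < 2 ^ b := Nat.mod_lt _ (by positivity)
  have hq : n / 2 ^ b % 2 = 0 := by
    rw [Nat.testBit_eq_decide_div_mod_eq] at h
    have := Nat.mod_two_eq_zero_or_one (n / 2 ^ b)
    simp at h
    omega
  have hdec : 2 ^ b * (n / 2 ^ b) + n % 2 ^ b = n := Nat.div_add_mod n _
  have h1 : 2 ^ b + n = 2 ^ b * (n / 2 ^ b + 1) + n % 2 ^ b := by rw [mul_add, mul_one]; omega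
  rw [h1, Nat.two_pow_add_eq_or_of_lt hr]
  conv_rhs => rw [← hdec, Nat.two_pow_add_eq_or_of_lt hr]
  refine Nat.eq_of_testBit_eq fun j => ?_
  simp only [Nat.testBit_or, Nat.testBit_xor, Nat.testBit_two_pow_mul, Nat.testBit_two_pow]
  rcases lt_trichotomy j b with hj | hj | hj
  · simp [hj.not_ge, hj.ne']
  · subst hj
    have h2 := Nat.testBit_lt_two_pow hr
    have h3 : (n / 2 ^ j + 1) % 2 = 1 := by omega
    simp [h2, Nat.testBit_zero, hq, h3]
  · have h2 : (n % 2 ^ b).testBit j = false := Nat.testBit_lt_two_pow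
      (hr.trans (Nat.pow_lt_pow_right (by norm_num) hj))
    obtain ⟨k, rfl⟩ : ∃ k, j = b + (k + 1) := ⟨j - b - 1, by omega⟩
    have h3 : (n / 2 ^ b + 1) / 2 = n / 2 ^ b / 2 := by omega
    simp [h2, Nat.testBit_succ, h3]

lemma testBit_flipBit {r m b n : ℕ} (h : (flipBit r m b).testBit n = true) :
    m.testBit (n ^^^ 2 ^ b) = true := by
  simp only [flipBit, Nat.testBit_or, Nat.testBit_and, Nat.testBit_shiftLeft,
    Nat.testBit_shiftRight, Bool.or_eq_true, Bool.and_eq_true, decide_eq_true_eq] at h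
  rcases h with ⟨h1, h2⟩ | ⟨h1, h2, h3⟩
  · rwa [← two_pow_add_eq_xor (testBit_lowMask h2)]
  · have := two_pow_add_eq_xor (testBit_lowMask h3)
    rw [Nat.add_sub_cancel' h1] at this
    rwa [this, Nat.xor_assoc, Nat.xor_self, Nat.xor_zero]

lemma testBit_xorShift {r m d k n : ℕ} (h : (xorShift r m d k).testBit n = true) :
    m.testBit (n ^^^ (d % 2 ^ k)) = true := by
  induction k generalizing n with
  | zero => simpa [xorShift, Nat.mod_one] using h
  | succ b ih =>
    have hlt : d % 2 ^ b < 2 ^ b := Nat.mod_lt _ (by positivity)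
    have hd : d % 2 ^ (b + 1) = 2 ^ b * (d / 2 ^ b % 2) + d % 2 ^ b := by
      rw [pow_succ, Nat.mod_mul]; ring
    rw [xorShift] at h
    cases hb : d.testBit b with
    | false =>
      rw [hb] at h
      have h0 : d / 2 ^ b % 2 = 0 := by
        rw [Nat.testBit_eq_decide_div_mod_eq] at hb
        have := Nat.mod_two_eq_zero_or_one (d / 2 ^ b)
        simp at hb
        omega
      rw [hd, h0, mul_zero, zero_add]
      exact ih h
    | true =>
      rw [hb] at h
      have h1 : d / 2 ^ b % 2 = 1 := by
        rw [Nat.testBit_eq_decide_div_mod_eq] at hb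
        simpa using hb
      have := ih (testBit_flipBit h)
      rwa [hd, h1, mul_one, two_pow_add_eq_xor (Nat.testBit_lt_two_pow hlt),
        Nat.xor_comm (d % 2 ^ b), ← Nat.xor_assoc]

lemma testBit_foldl_or {α : Type*} (f : α → ℕ) (C : List α) (m n : ℕ)
    (h : (C.foldl (fun acc g => acc ||| f g) m).testBit n = true) :
    m.testBit n = true ∨ ∃ g ∈ C, (f g).testBit n = true := by
  induction C generalizing m with
  | nil => exact Or.inl h
  | cons g C ih =>
    rcases ih _ h with h | ⟨g', hg', h⟩
    · rw [Nat.testBit_or, Bool.or_eq_true] at h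
      rcases h with h | h
      · exact Or.inl h
      · exact Or.inr ⟨g, by simp, h⟩
    · exact Or.inr ⟨g', by simp [hg'], h⟩

lemma testBit_foldr_or (l : List ℕ) (n : ℕ) (h : (l.foldr (· ||| ·) 0).testBit n = true) :
    ∃ m ∈ l, m.testBit n = true := by
  induction l with
  | nil => simp at h
  | cons m l ih =>
    rw [List.foldr_cons, Nat.testBit_or, Bool.or_eq_true] at h
    rcases h with h | h
    · exact ⟨m, by simp, h⟩
    · obtain ⟨m', hm', h⟩ := ih h
      exact ⟨m', by simp [hm'], h⟩

lemma testBit_addClass {r : ℕ} {C : List ℕ} (hC : ∀ g ∈ C, g < 2 ^ r) (prev : ℕ) (ms : List ℕ)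
    (c n : ℕ) (h : ((addClass r C prev ms).getD c 0).testBit n = true) :
    (ms.getD c 0).testBit n = true ∨
      ∃ g ∈ C, ((prev :: ms).getD c 0).testBit (n ^^^ g) = true := by
  induction ms generalizing prev c with
  | nil => simp [addClass] at h
  | cons m ms ih =>
    cases c with
    | zero =>
      simp only [addClass, List.getD_cons_zero] at h ⊢
      rcases testBit_foldl_or _ _ _ _ h with h | ⟨g, hg, h⟩
      · exact Or.inl h
      · refine Or.inr ⟨g, hg, ?_⟩
        have := testBit_xorShift h
        rwa [Nat.mod_eq_of_lt (hC g hg)] at this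
    | succ c =>
      simp only [addClass, List.getD_cons_succ] at h ⊢
      exact ih _ _ h

lemma fst_lt_of_mem_colouredColumns {cs : List (List ℕ)} {p : ℕ × ℕ}
    (hp : p ∈ colouredColumns cs) : p.1 < cs.length := by
  induction cs with
  | nil => simp [colouredColumns] at hp
  | cons C cs ih =>
    simp only [colouredColumns, List.mem_append, List.mem_map] at hp
    rcases hp with ⟨g, -, rfl⟩ | hp
    · simp
    · have := ih hp
      simp only [List.length_cons]
      omega

lemma testBit_rainbowSums {r R : ℕ} {cs : List (List ℕ)}
    (hcs : ∀ p ∈ colouredColumns cs, p.2 < 2 ^ r) (c n : ℕ)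
    (h : ((rainbowSums r R cs).getD c 0).testBit n = true) :
    ∃ l : List (ℕ × ℕ), (∀ p ∈ l, p ∈ colouredColumns cs) ∧ (l.map Prod.fst).Nodup ∧
      l.length = c ∧ (l.map Prod.snd).foldr (· ^^^ ·) 0 = n := by
  induction cs generalizing c n with
  | nil =>
    cases c with
    | zero =>
      refine ⟨[], by simp, by simp, rfl, ?_⟩
      simp only [rainbowSums, List.getD_cons_zero] at h
      rcases Nat.eq_zero_or_pos n with hn | hn
      · simp [hn]
      · rw [Nat.testBit_lt_two_pow (Nat.one_lt_two_pow hn.ne')] at h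
        simp at h
    | succ c =>
      exfalso
      simp only [rainbowSums, List.getD_cons_succ] at h
      have : (List.replicate R 0).getD c 0 = 0 := by
        simp only [List.getD_eq_getElem?_getD, List.getElem?_replicate]
        split_ifs <;> rfl
      rw [this] at h
      simp at h
  | cons C cs ih =>
    have h1 : ∀ g ∈ C, g < 2 ^ r := fun g hg =>
      hcs (cs.length, g) (by simp [colouredColumns, hg])
    have h2 : ∀ p ∈ colouredColumns cs, p.2 < 2 ^ r := fun p hp =>
      hcs p (by simp [colouredColumns, hp])
    rcases testBit_addClass h1 _ _ _ _ h with h | ⟨g, hg, h⟩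
    · obtain ⟨l, hl, h3⟩ := ih h2 _ _ h
      exact ⟨l, fun p hp => by simp [colouredColumns, hl p hp], h3⟩
    · cases c with
      | zero => simp at h
      | succ c =>
        rw [List.getD_cons_succ] at h
        obtain ⟨l, hl, h3, h4, h5⟩ := ih h2 _ _ h
        refine ⟨(cs.length, g) :: l, ?_, ?_, by simp [h4], ?_⟩
        · intro p hp
          rcases List.mem_cons.1 hp with rfl | hp
          · simp [colouredColumns, hg]
          · simp [colouredColumns, hl p hp]
        · rw [List.map_cons, List.nodup_cons]
          refine ⟨fun hmem => ?_, h3⟩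
          obtain ⟨p, hp, hpe⟩ := List.mem_map.1 hmem
          have := fst_lt_of_mem_colouredColumns (hl p hp)
          simp only at hpe
          omega
        · rw [List.map_cons, List.foldr_cons, h5, Nat.xor_comm, Nat.xor_assoc, Nat.xor_self,
            Nat.xor_zero]

lemma colouredCovers_of_isFull {r ℓ R : ℕ} {cs : List (List ℕ)}
    (hcs : ∀ p ∈ colouredColumns cs, p.2 < 2 ^ r) (h : isFull r ℓ R cs = true) :
    ColouredCovers (fun p : {p // p ∈ colouredColumns cs} => bitVec r p.1.2)
      (fun p => p.1.1) ℓ R := by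
  intro v
  obtain ⟨n, hn, rfl⟩ := exists_bitVec_eq v
  have hlen : (rainbowSums r R cs).length = R + 1 := by
    have haux : ∀ (C : List ℕ) (ms : List ℕ) (p : ℕ), (addClass r C p ms).length = ms.length := by
      intro C ms
      induction ms with
      | nil => simp [addClass]
      | cons m ms ih => simp [addClass, ih]
    clear h hcs
    induction cs with
    | nil => simp [rainbowSums]
    | cons C cs ih => rw [rainbowSums, haux, ih]
  have hbit : (((rainbowSums r R cs).drop ℓ).foldr (· ||| ·) 0).testBit n = true := by
    rw [isFull, beq_iff_eq] at h
    rw [h, Nat.testBit_two_pow_sub_one]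
    simpa using hn
  obtain ⟨m, hm, hbit⟩ := testBit_foldr_or _ _ hbit
  obtain ⟨c, hc, rfl⟩ := List.getElem_of_mem hm
  rw [List.length_drop, hlen] at hc
  rw [List.getElem_drop] at hbit
  obtain ⟨l, hl, h1, h2, h3⟩ := testBit_rainbowSums (R := R) hcs (ℓ + c) n (by
    rw [List.getD_eq_getElem _ _ (by omega)]
    exact hbit)
  refine ⟨l.attach.map fun p => ⟨p.1, hl p.1 p.2⟩, by simp [h2], by simp [h2]; omega, ?_, ?_⟩
  · rw [List.map_map]
    have : ((fun p : {p // p ∈ colouredColumns cs} => p.1.1) ∘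
        fun p : {x // x ∈ l} => (⟨p.1, hl p.1 p.2⟩ : {p // p ∈ colouredColumns cs})) =
        Prod.fst ∘ Subtype.val := rfl
    rw [this, ← List.map_map, List.attach_map_subtype_val]
    exact h1
  · rw [← h3, bitVec_foldr_xor, List.map_map, List.map_map]
    have : ((fun p : {p // p ∈ colouredColumns cs} => bitVec r p.1.2) ∘
        fun p : {x // x ∈ l} => (⟨p.1, hl p.1 p.2⟩ : {p // p ∈ colouredColumns cs})) =
        (bitVec r ∘ Prod.snd) ∘ Subtype.val := rfl
    rw [this, ← List.map_map, List.attach_map_subtype_val]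

/-! ### Linear systems over a field -/

lemma exists_sum_pow_mul_eq {K : Type*} [Field K] {n : ℕ} {b : Fin n → K}
    (hb : Function.Injective b) (c : Fin n → K) :
    ∃ x : Fin n → K, ∀ e : Fin n, ∑ j, b j ^ (e : ℕ) * x j = c e := by
  have hdet : IsUnit (Matrix.vandermonde b).transpose.det := by
    rw [Matrix.det_transpose, isUnit_iff_ne_zero]
    exact Matrix.det_vandermonde_ne_zero_iff.2 hb
  refine ⟨(Matrix.vandermonde b).transpose⁻¹.mulVec c, fun e => ?_⟩
  have := congrFun (Matrix.mulVec_mulVec c (Matrix.vandermonde b).transpose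
    (Matrix.vandermonde b).transpose⁻¹) e
  rw [Matrix.mul_nonsing_inv _ hdet, Matrix.one_mulVec] at this
  rw [← this]
  simp [Matrix.mulVec, dotProduct, Matrix.vandermonde_apply]

lemma exists_vandermonde_two {K : Type*} [Field K] {b₁ b₂ : K} (h : b₁ ≠ b₂) (c₀ c₁ : K) :
    ∃ x y, x + y = c₀ ∧ b₁ * x + b₂ * y = c₁ := by
  have hb : Function.Injective ![b₁, b₂] := by
    intro i j
    fin_cases i <;> fin_cases j <;> simp [h, h.symm]
  obtain ⟨x, hx⟩ := exists_sum_pow_mul_eq hb ![c₀, c₁]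
  refine ⟨x 0, x 1, ?_, ?_⟩
  · simpa [Fin.sum_univ_succ] using hx 0
  · simpa [Fin.sum_univ_succ] using hx 1

lemma exists_vandermonde_three {K : Type*} [Field K] {b₁ b₂ b₃ : K} (h : [b₁, b₂, b₃].Nodup)
    (c₀ c₁ c₂ : K) :
    ∃ x y z, x + (y + z) = c₀ ∧ b₁ * x + (b₂ * y + b₃ * z) = c₁ ∧
      b₁ ^ 2 * x + (b₂ ^ 2 * y + b₃ ^ 2 * z) = c₂ := by
  have hb : Function.Injective ![b₁, b₂, b₃] := by
    rw [← List.nodup_ofFn]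
    simpa using h
  obtain ⟨x, hx⟩ := exists_sum_pow_mul_eq hb ![c₀, c₁, c₂]
  refine ⟨x 0, x 1, x 2, ?_, ?_, ?_⟩
  · simpa [Fin.sum_univ_succ] using hx 0
  · simpa [Fin.sum_univ_succ] using hx 1
  · simpa [Fin.sum_univ_succ] using hx 2

lemma exists_vandermonde_four {K : Type*} [Field K] {b₁ b₂ b₃ b₄ : K}
    (h : [b₁, b₂, b₃, b₄].Nodup) (c₀ c₁ c₂ c₃ : K) :
    ∃ x y z w, x + (y + (z + w)) = c₀ ∧ b₁ * x + (b₂ * y + (b₃ * z + b₄ * w)) = c₁ ∧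
      b₁ ^ 2 * x + (b₂ ^ 2 * y + (b₃ ^ 2 * z + b₄ ^ 2 * w)) = c₂ ∧
      b₁ ^ 3 * x + (b₂ ^ 3 * y + (b₃ ^ 3 * z + b₄ ^ 3 * w)) = c₃ := by
  have hb : Function.Injective ![b₁, b₂, b₃, b₄] := by
    rw [← List.nodup_ofFn]
    simpa using h
  obtain ⟨x, hx⟩ := exists_sum_pow_mul_eq hb ![c₀, c₁, c₂, c₃]
  refine ⟨x 0, x 1, x 2, x 3, ?_, ?_, ?_, ?_⟩
  · simpa [Fin.sum_univ_succ] using hx 0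
  · simpa [Fin.sum_univ_succ] using hx 1
  · simpa [Fin.sum_univ_succ] using hx 2
  · simpa [Fin.sum_univ_succ] using hx 3

/-- In characteristic `2`, deleting the row of first powers from a Vandermonde system leaves a
solvable system, because squaring is injective: the point `(0, 1, 0)` is the nucleus of the conic
of all `(1, b, b²)`. -/
lemma exists_vandermonde_sq {K : Type*} [Field K] [CharP K 2] {b₁ b₂ : K} (h : b₁ ≠ b₂)
    (c₀ c₂ : K) : ∃ x y, x + y = c₀ ∧ b₁ ^ 2 * x + b₂ ^ 2 * y = c₂ :=
  exists_vandermonde_two (fun h' => h (CharTwo.sq_injective h')) _ _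

lemma eq_zero_or_exists_unit {K : Type*} [Field K] (x : K) : x = 0 ∨ ∃ w : Kˣ, (w : K) = x := by
  rcases eq_or_ne x 0 with h | h
  · exact Or.inl h
  · exact Or.inr ⟨Units.mk0 x h, rfl⟩

/-! ### Lengthening column systems -/

/-- The columns `h i` are those of a parity-check matrix of a code of minimum distance `3`. -/
structure IsDistanceThree {ι V : Type*} [AddCommMonoid V] (h : ι → V) : Prop where
  injective : Function.Injective h
  ne_zero : ∀ i, h i ≠ 0
  triple : ∃ i j k, h i + h j = h k

/-- Lengthening for covering radius `2`. -/
def liftTwo {ι A K : Type*} [AddCommGroup A] [Field K] (h : ι → A) (κ : ι → K) :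
    (ι × K) ⊕ Kˣ → A × K × K
  | .inl (i, ξ) => (h i, ξ, κ i * ξ)
  | .inr w => (0, 0, w)

open Classical in
/-- The colouring of the columns of `liftTwo h κ` with `2 · |K|` colours. Here `s` selects one
column of each colour. The colour of the added columns is freed by merging the columns
`(i₁, 0)` and `(i₂, 0)`. -/
noncomputable def liftTwoColour {ι K : Type*} [Field K] (κ : ι → K) (s : K → ι) (i₁ i₂ : ι) :
    (ι × K) ⊕ Kˣ → K × Bool
  | .inl (i, ξ) =>
    if i = s (κ i) ∧ ξ = 0 then (if i = i₂ then κ i₁ else κ i, true) else (κ i, false)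
  | .inr _ => (κ i₂, true)

section LiftTwo

variable {ι A K : Type*} [AddCommGroup A] [Field K] {h : ι → A} {κ : ι → K}

lemma liftTwo_injective (hi : Function.Injective h) (h0 : ∀ i, h i ≠ 0) :
    Function.Injective (liftTwo h κ) := by
  rintro (⟨i, x⟩ | w) (⟨j, y⟩ | w') he <;> simp only [liftTwo, Prod.mk.injEq] at he
  · rw [hi he.1, he.2.1]
  · exact absurd he.1 (h0 i)
  · exact absurd he.1.symm (h0 j)
  · rw [Units.ext he.2.2]

lemma liftTwo_ne_zero (h0 : ∀ i, h i ≠ 0) (i) : liftTwo h κ i ≠ 0 := by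
  rcases i with ⟨i, x⟩ | w
  · simp [liftTwo, h0 i]
  · simp [liftTwo]

variable [Module (ZMod 2) A] {s : K → ι} {i₁ i₂ i₃ : ι}

/-- The sums `(0, b, c)` with `b ≠ 0` come from two columns over the same `i`, with
`κ i = c / b`: this is why all elements of `K` have to be colours. -/
theorem colouredCovers_liftTwo (H : ColouredCovers h κ 0 2) (hs : ∀ b, κ (s b) = b)
    (hs₁ : s (κ i₁) = i₁) (hs₂ : s (κ i₂) = i₂) (h₃ : h i₁ + h i₂ = h i₃) (h₁₂ : κ i₁ ≠ κ i₂) :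
    ColouredCovers (liftTwo h κ) (liftTwoColour κ s i₁ i₂) 0 2 := by
  classical
  rintro ⟨a, b, c⟩
  obtain ⟨l, -, hl2, hnd, rfl⟩ := H a
  rcases l with _ | ⟨i, _ | ⟨j, _ | ⟨k, l⟩⟩⟩
  · rcases eq_or_ne b 0 with rfl | hb
    · rcases eq_zero_or_exists_unit c with rfl | ⟨w, rfl⟩
      · exact ⟨[], by simp, by simp, by simp, rfl⟩
      · exact ⟨[.inr w], by simp [liftTwo]⟩
    · refine ⟨[.inl (s (c / b), 0), .inl (s (c / b), b)], by simp, by simp, ?_, ?_⟩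
      · simp [liftTwoColour, hs, hb]
      · simp [liftTwo, hs, div_mul_cancel₀ _ hb, ZModModule.add_self]
  · rcases eq_zero_or_exists_unit (c - κ i * b) with h0 | ⟨w, hw⟩
    · refine ⟨[.inl (i, b)], by simp, by simp, by simp, ?_⟩
      simp [liftTwo, sub_eq_zero.1 h0]
    · refine ⟨[.inl (i, b), .inr w], by simp, by simp, ?_, by simp [liftTwo, hw]⟩
      simp only [List.map_cons, List.map_nil, List.nodup_cons, List.mem_singleton,
        List.not_mem_nil, not_false_eq_true, List.nodup_nil, and_true, liftTwoColour]
      split_ifs with h1 h2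
      · simp [h₁₂]
      · simp only [Prod.mk.injEq, and_true]
        intro h3
        exact h2 (by rw [h1.1, h3, hs₂])
      · simp
  · simp only [List.map_cons, List.map_nil, List.nodup_cons, List.mem_singleton,
        List.not_mem_nil, not_false_eq_true, List.nodup_nil, and_true] at hnd
    obtain ⟨x, y, h1, h2⟩ := exists_vandermonde_two hnd b c
    by_cases hc : liftTwoColour κ s i₁ i₂ (.inl (i, x)) = liftTwoColour κ s i₁ i₂ (.inl (j, y))
    · -- the two columns are the merged ones, whose sum is the column `(i₃, 0)`
      have hij : ((i = i₁ ∧ j = i₂) ∨ (i = i₂ ∧ j = i₁)) ∧ x = 0 ∧ y = 0 := by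
        simp only [liftTwoColour] at hc
        by_cases hI : i = s (κ i) ∧ x = 0 <;> by_cases hJ : j = s (κ j) ∧ y = 0
        · refine ⟨?_, hI.2, hJ.2⟩
          rw [if_pos hI, if_pos hJ] at hc
          replace hc : (if i = i₂ then κ i₁ else κ i) = if j = i₂ then κ i₁ else κ j := by
            simpa using hc
          split_ifs at hc with h3 h4 h4
          · exact absurd (by rw [h3, h4]) hnd
          · exact Or.inr ⟨h3, by rw [hJ.1, ← hc, hs₁]⟩
          · exact Or.inl ⟨by rw [hI.1, hc, hs₁], h4⟩
          · exact absurd hc hnd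
        · rw [if_pos hI, if_neg hJ] at hc
          simp at hc
        · rw [if_neg hI, if_pos hJ] at hc
          simp at hc
        · rw [if_neg hI, if_neg hJ] at hc
          exact absurd (by simpa using hc) hnd
      obtain ⟨h4, rfl, rfl⟩ := hij
      have h5 : h i + h j = h i₃ := by
        rcases h4 with ⟨rfl, rfl⟩ | ⟨rfl, rfl⟩
        · exact h₃
        · rw [add_comm, h₃]
      refine ⟨[.inl (i₃, 0)], by simp, by simp, by simp, ?_⟩
      simp only [add_zero, mul_zero] at h1 h2
      simp [liftTwo, ← h5, ← h1, ← h2]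
    · refine ⟨[.inl (i, x), .inl (j, y)], by simp, by simp, by simpa using hc, ?_⟩
      simp [liftTwo, h1, h2]
  · simp at hl2

lemma liftTwo_triple (h0 : ∀ i, h i ≠ 0)
    (hs₁ : s (κ i₁) = i₁) (h₃ : h i₁ + h i₂ = h i₃) :
    ∃ i j k, liftTwo h κ i + liftTwo h κ j = liftTwo h κ k ∧
      liftTwoColour κ s i₁ i₂ i ≠ liftTwoColour κ s i₁ i₂ j := by
  classical
  have h31 : i₃ ≠ i₁ := by
    rintro rfl
    exact h0 i₂ (by simpa using h₃)
  have h32 : i₃ ≠ i₂ := by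
    rintro rfl
    exact h0 i₁ (by simpa using h₃)
  have h12 : i₁ ≠ i₂ := by
    rintro rfl
    rw [ZModModule.add_self] at h₃
    exact h0 _ h₃.symm
  refine ⟨.inl (i₃, 0), .inl (i₁, 0), .inl (i₂, 0), ?_, ?_⟩
  · have : h i₃ + h i₁ = h i₂ := by
      rw [← h₃, add_comm, ← add_assoc, ZModModule.add_self, zero_add]
    simp [liftTwo, this]
  · simp only [liftTwoColour, hs₁, h32, h12, and_true, if_true, if_false]
    split_ifs with h1
    · simp only [ne_eq, Prod.mk.injEq, and_true]
      intro h2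
      exact h31 (by rw [h1, h2, hs₁])
    · simp

end LiftTwo

/-- Lengthening for covering radius `3`; the added columns sit at the nucleus of the conic. -/
def liftThree {ι A K : Type*} [AddCommGroup A] [Field K] (h : ι → A) (κ : ι → K) :
    (ι × K) ⊕ Kˣ → A × K × K × K
  | .inl (i, ξ) => (h i, ξ, κ i * ξ, κ i ^ 2 * ξ)
  | .inr w => (0, 0, w, 0)

/-- Lengthening for covering radius `4`; the added columns sit at the point at infinity of the
twisted cubic. -/
def liftFour {ι A K : Type*} [AddCommGroup A] [Field K] (h : ι → A) (κ : ι → K) :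
    (ι × K) ⊕ Kˣ → A × K × K × K × K
  | .inl (i, ξ) => (h i, ξ, κ i * ξ, κ i ^ 2 * ξ, κ i ^ 3 * ξ)
  | .inr w => (0, 0, 0, 0, w)

/-- Lengthening for covering radius `4`, with added columns at two points that are independent of
any two points of the twisted cubic. -/
def liftFourTwice {ι A K : Type*} [AddCommGroup A] [Field K] (h : ι → A) (κ : ι → K) :
    (ι × K) ⊕ Kˣ ⊕ Kˣ → A × K × K × K × K
  | .inl (i, ξ) => (h i, ξ, κ i * ξ, κ i ^ 2 * ξ, κ i ^ 3 * ξ)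
  | .inr (.inl w) => (0, 0, 0, 0, w)
  | .inr (.inr w) => (0, 0, w, 0, 0)

section Lift

variable {ι A K : Type*} [AddCommGroup A] [Field K] {h : ι → A} {κ : ι → K}

lemma exists_units_add (hK : 2 < Nat.card K) : ∃ u v w : Kˣ, (u : K) + v = w := by
  have : Finite K := Nat.finite_of_card_ne_zero (by omega)
  have : Fintype K := Fintype.ofFinite K
  classical
  obtain ⟨x, hx⟩ : ∃ x : K, x ∉ ({0, -1} : Finset K) := by
    by_contra! hx
    have h1 : Fintype.card K ≤ ({0, -1} : Finset K).card :=
      Finset.card_le_card fun x _ => hx x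
    have h2 : ({0, -1} : Finset K).card ≤ 2 := Finset.card_le_two
    rw [Nat.card_eq_fintype_card] at hK
    omega
  simp only [Finset.mem_insert, Finset.mem_singleton, not_or] at hx
  have h1 : x + 1 ≠ 0 := fun h => hx.2 (eq_neg_of_add_eq_zero_left h)
  exact ⟨Units.mk0 x hx.1, 1, Units.mk0 _ h1, by simp⟩

lemma isDistanceThree_liftThree (hK : 2 < Nat.card K) (hi : Function.Injective h)
    (h0 : ∀ i, h i ≠ 0) : IsDistanceThree (liftThree h κ) where
  injective := by
    rintro (⟨i, x⟩ | w) (⟨j, y⟩ | w') he <;> simp only [liftThree, Prod.mk.injEq] at he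
    · rw [hi he.1, he.2.1]
    · exact absurd he.1 (h0 i)
    · exact absurd he.1.symm (h0 j)
    · rw [Units.ext he.2.2.1]
  ne_zero := by
    rintro (⟨i, x⟩ | w)
    · simp [liftThree, h0 i]
    · simp [liftThree]
  triple := by
    obtain ⟨u, v, w, huv⟩ := exists_units_add hK
    exact ⟨.inr u, .inr v, .inr w, by simp [liftThree, huv]⟩

lemma isDistanceThree_liftFour (hK : 2 < Nat.card K) (hi : Function.Injective h)
    (h0 : ∀ i, h i ≠ 0) : IsDistanceThree (liftFour h κ) where
  injective := by
    rintro (⟨i, x⟩ | w) (⟨j, y⟩ | w') he <;> simp only [liftFour, Prod.mk.injEq] at he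
    · rw [hi he.1, he.2.1]
    · exact absurd he.1 (h0 i)
    · exact absurd he.1.symm (h0 j)
    · rw [Units.ext he.2.2.2.2]
  ne_zero := by
    rintro (⟨i, x⟩ | w)
    · simp [liftFour, h0 i]
    · simp [liftFour]
  triple := by
    obtain ⟨u, v, w, huv⟩ := exists_units_add hK
    exact ⟨.inr u, .inr v, .inr w, by simp [liftFour, huv]⟩

lemma isDistanceThree_liftFourTwice (hK : 2 < Nat.card K) (hi : Function.Injective h)
    (h0 : ∀ i, h i ≠ 0) : IsDistanceThree (liftFourTwice h κ) where
  injective := by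
    rintro (⟨i, x⟩ | w | w) (⟨j, y⟩ | w' | w') he <;>
      simp only [liftFourTwice, Prod.mk.injEq] at he
    · rw [hi he.1, he.2.1]
    · exact absurd he.1 (h0 i)
    · exact absurd he.1 (h0 i)
    · exact absurd he.1.symm (h0 j)
    · rw [Units.ext he.2.2.2.2]
    · exact absurd he.2.2.2.2 w.ne_zero
    · exact absurd he.1.symm (h0 j)
    · exact absurd he.2.2.1 w.ne_zero
    · rw [Units.ext he.2.2.1]
  ne_zero := by
    rintro (⟨i, x⟩ | w | w)
    · simp [liftFourTwice, h0 i]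
    · simp [liftFourTwice]
    · simp [liftFourTwice]
  triple := by
    obtain ⟨u, v, w, huv⟩ := exists_units_add hK
    exact ⟨.inr (.inl u), .inr (.inl v), .inr (.inl w), by simp [liftFourTwice, huv]⟩

theorem covers_liftThree [CharP K 2] (H : ColouredCovers h κ 2 3) : Covers (liftThree h κ) 3 := by
  rintro ⟨a, b, c, d⟩
  obtain ⟨l, hl2, hl3, hnd, rfl⟩ := H a
  rcases l with _ | ⟨i, _ | ⟨j, _ | ⟨k, _ | ⟨m, l⟩⟩⟩⟩
  · simp at hl2
  · simp at hl2
  · obtain ⟨x, y, h1, h2⟩ := exists_vandermonde_sq (by simpa using hnd : κ i ≠ κ j) b d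
    rcases eq_zero_or_exists_unit (c - (κ i * x + κ j * y)) with h0 | ⟨w, hw⟩
    · exact ⟨[.inl (i, x), .inl (j, y)], by simp, by simp [liftThree, h1, h2, sub_eq_zero.1 h0]⟩
    · exact ⟨[.inl (i, x), .inl (j, y), .inr w], by simp,
        by simp [liftThree, h1, h2, hw]; ring⟩
  · obtain ⟨x, y, z, h1, h2, h3⟩ := exists_vandermonde_three hnd b c d
    exact ⟨[.inl (i, x), .inl (j, y), .inl (k, z)], by simp, by simp [liftThree, h1, h2, h3]⟩
  · simp at hl3; omega

theorem covers_liftFour (H : ColouredCovers h κ 3 4) : Covers (liftFour h κ) 4 := by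
  rintro ⟨a, b, c, d, e⟩
  obtain ⟨l, hl3, hl4, hnd, rfl⟩ := H a
  rcases l with _ | ⟨i, _ | ⟨j, _ | ⟨k, _ | ⟨m, _ | ⟨n, l⟩⟩⟩⟩⟩
  · simp at hl3
  · simp at hl3
  · simp at hl3
  · obtain ⟨x, y, z, h1, h2, h3⟩ := exists_vandermonde_three hnd b c d
    rcases eq_zero_or_exists_unit (e - (κ i ^ 3 * x + (κ j ^ 3 * y + κ k ^ 3 * z))) with
      h0 | ⟨w, hw⟩
    · exact ⟨[.inl (i, x), .inl (j, y), .inl (k, z)], by simp,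
        by simp [liftFour, h1, h2, h3, sub_eq_zero.1 h0]⟩
    · exact ⟨[.inl (i, x), .inl (j, y), .inl (k, z), .inr w], by simp,
        by simp [liftFour, h1, h2, h3, hw]; ring⟩
  · obtain ⟨x, y, z, t, h1, h2, h3, h4⟩ := exists_vandermonde_four hnd b c d e
    exact ⟨[.inl (i, x), .inl (j, y), .inl (k, z), .inl (m, t)], by simp,
      by simp [liftFour, h1, h2, h3, h4]⟩
  · simp at hl4; omega

/-- The colouring of the columns of `liftFourTwice h κ` given by a partition `S` of `K` into three
parts. -/
def liftFourTwiceColour (κ : ι → K) (S : K → Fin 3) : (ι × K) ⊕ Kˣ ⊕ Kˣ → (K × Fin 3) ⊕ Bool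
  | .inl (i, ξ) => .inl (κ i, S ξ)
  | .inr (.inl _) => .inr false
  | .inr (.inr _) => .inr true

/-- A sum of two columns that uses none of the added ones becomes a sum of four, because one of
its columns is a sum of three with the same `i`. -/
theorem colouredCovers_liftFourTwice [Module (ZMod 2) A] [CharP K 2] (H : ColouredCovers h κ 2 4)
    {S : K → Fin 3} (hS : ∀ ξ, ∃ a b c, a + (b + c) = ξ ∧ S a = 0 ∧ S b = 1 ∧ S c = 2) :
    ColouredCovers (liftFourTwice h κ) (liftFourTwiceColour κ S) 3 4 := by
  rintro ⟨a, b, c, d, e⟩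
  obtain ⟨l, hl2, hl4, hnd, rfl⟩ := H a
  rcases l with _ | ⟨i, _ | ⟨j, _ | ⟨k, _ | ⟨m, _ | ⟨n, l⟩⟩⟩⟩⟩
  · simp at hl2
  · simp at hl2
  · have hne : κ i ≠ κ j := by simpa using hnd
    obtain ⟨x, y, h1, h2⟩ := exists_vandermonde_sq hne b d
    rcases eq_zero_or_exists_unit (c - (κ i * x + κ j * y)) with h0 | ⟨w, hw⟩ <;>
    rcases eq_zero_or_exists_unit (e - (κ i ^ 3 * x + κ j ^ 3 * y)) with h0' | ⟨w', hw'⟩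
    · obtain ⟨p, q, r, hx, hp, hq, hr⟩ := hS x
      refine ⟨[.inl (i, p), .inl (i, q), .inl (i, r), .inl (j, y)], by simp, by simp, ?_, ?_⟩
      · simp [liftFourTwiceColour, hp, hq, hr, hne]
      · have h3 : h i + (h i + (h i + h j)) = h i + h j := by
          rw [← add_assoc, ZModModule.add_self, zero_add]
        have h5 : ∀ t u : K, t * p + (t * q + (t * r + u)) = t * x + u := fun t u => by
          rw [← hx]; ring
        have h6 : p + (q + (r + y)) = b := by rw [← h1, ← hx]; ring
        simp [liftFourTwice, h3, h5, h6, h2, sub_eq_zero.1 h0, sub_eq_zero.1 h0']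
    · exact ⟨[.inl (i, x), .inl (j, y), .inr (.inl w')], by simp, by simp,
        by simp [liftFourTwiceColour, hne],
        by simp [liftFourTwice, h1, h2, hw', sub_eq_zero.1 h0]; ring⟩
    · exact ⟨[.inl (i, x), .inl (j, y), .inr (.inr w)], by simp, by simp,
        by simp [liftFourTwiceColour, hne],
        by simp [liftFourTwice, h1, h2, hw, sub_eq_zero.1 h0']; ring⟩
    · refine ⟨[.inl (i, x), .inl (j, y), .inr (.inl w'), .inr (.inr w)], by simp, by simp,
        by simp [liftFourTwiceColour, hne], ?_⟩
      simp [liftFourTwice, h1, h2, hw, hw']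
      constructor <;> ring
  · obtain ⟨x, y, z, h1, h2, h3⟩ := exists_vandermonde_three hnd b c d
    simp only [List.map_cons, List.map_nil, List.nodup_cons, List.mem_cons,
      List.not_mem_nil, or_false, not_or, not_false_eq_true, List.nodup_nil, and_true] at hnd
    rcases eq_zero_or_exists_unit (e - (κ i ^ 3 * x + (κ j ^ 3 * y + κ k ^ 3 * z))) with
      h0 | ⟨w, hw⟩
    · exact ⟨[.inl (i, x), .inl (j, y), .inl (k, z)], by simp, by simp,
        by simp [liftFourTwiceColour, hnd],
        by simp [liftFourTwice, h1, h2, h3, sub_eq_zero.1 h0]⟩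
    · exact ⟨[.inl (i, x), .inl (j, y), .inl (k, z), .inr (.inl w)], by simp, by simp,
        by simp [liftFourTwiceColour, hnd],
        by simp [liftFourTwice, h1, h2, h3, hw]; ring⟩
  · obtain ⟨x, y, z, t, h1, h2, h3, h4⟩ := exists_vandermonde_four hnd b c d e
    simp only [List.map_cons, List.map_nil, List.nodup_cons, List.mem_cons,
      List.not_mem_nil, or_false, not_or, not_false_eq_true, List.nodup_nil, and_true] at hnd
    exact ⟨[.inl (i, x), .inl (j, y), .inl (k, z), .inl (m, t)], by simp, by simp,
      by simp [liftFourTwiceColour, hnd],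
      by simp [liftFourTwice, h1, h2, h3, h4]⟩
  · simp at hl4; omega

/-! ### Combining the Golay code with a code of covering radius `2` -/

/-- The columns over those of a perfect code `g` with distinct labels `β i`, together with the
columns of a Hamming code in the first coordinate over `K` and with columns `u j` in the last
two. -/
def liftPerfect {ι J A K : Type*} [AddCommGroup A] [Field K] (g : ι → A) (β : ι → K)
    (u : J → K × K) : (ι × K) ⊕ Kˣ ⊕ J → A × K × K × K
  | .inl (i, ξ) => (g i, ξ, β i * ξ, β i ^ 2 * ξ)
  | .inr (.inl w) => (0, w, 0, 0)
  | .inr (.inr j) => (0, 0, u j)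

/-- The colouring of the columns of `liftPerfect g β u` by a partition `S` of `Kˣ` into two parts
and a colouring `κ` of the columns `u j`. -/
def liftPerfectColour {ι J C K : Type*} [Field K] (S : Kˣ → Bool) (κ : J → C) :
    (ι × K) ⊕ Kˣ ⊕ J → ι ⊕ Bool ⊕ C
  | .inl (i, _) => .inl i
  | .inr (.inl w) => .inr (.inl (S w))
  | .inr (.inr j) => .inr (.inr (κ j))

lemma isDistanceThree_liftPerfect {J : Type*} {u : J → K × K} (hK : 2 < Nat.card K)
    (hi : Function.Injective h) (h0 : ∀ i, h i ≠ 0) (hu : Function.Injective u)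
    (hu0 : ∀ j, u j ≠ 0) : IsDistanceThree (liftPerfect h κ u) where
  injective := by
    rintro (⟨i, x⟩ | w | w) (⟨j, y⟩ | w' | w') he <;>
      simp only [liftPerfect, Prod.mk.injEq] at he
    · rw [hi he.1, he.2.1]
    · exact absurd he.1 (h0 i)
    · exact absurd he.1 (h0 i)
    · exact absurd he.1.symm (h0 j)
    · rw [Units.ext he.2.1]
    · exact absurd he.2.1 w.ne_zero
    · exact absurd he.1.symm (h0 j)
    · exact absurd he.2.1.symm w'.ne_zero
    · rw [hu he.2.2]
  ne_zero := by
    rintro (⟨i, x⟩ | w | w)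
    · simp [liftPerfect, h0 i]
    · simp [liftPerfect]
    · simp [liftPerfect, hu0 w]
  triple := by
    obtain ⟨u, v, w, huv⟩ := exists_units_add hK
    exact ⟨.inr (.inl u), .inr (.inl v), .inr (.inl w), by simp [liftPerfect, huv]⟩

/-- A single column over `i` is a sum of three columns by the last hypothesis, `hhit`. -/
theorem colouredCovers_liftPerfect {J C : Type*} {u : J → K × K} {κ' : J → C} {S : Kˣ → Bool}
    [CharP K 2] (H : ColouredCovers h (id : ι → ι) 0 3) (hκ : Function.Injective κ)
    (hκ0 : ∀ i, κ i ≠ 0) (hu : ColouredCovers u κ' 0 2) (hu' : ColouredCovers u κ' 2 3)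
    (hS : ∀ w : Kˣ, ∃ w₁ w₂ : Kˣ, (w₁ + w₂ : K) = w ∧ S w₁ ≠ S w₂)
    (hhit : ∀ i, ∃ (δ : Kˣ) (j : J), u j = (κ i * δ, κ i ^ 2 * δ)) :
    ColouredCovers (liftPerfect h κ u) (liftPerfectColour S κ') 2 3 := by
  have hsum : ∀ l : List J, (l.map fun j => liftPerfect h κ u (.inr (.inr j))).sum =
      (0, 0, (l.map u).sum) := fun l => by
    induction l with
    | nil => rfl
    | cons j l ih =>
      rw [List.map_cons, List.sum_cons, ih]
      simp [liftPerfect]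
  have hcol : ∀ l : List J, (l.map κ').Nodup →
      (l.map fun j => liftPerfectColour (ι := ι) S κ' (.inr (.inr j))).Nodup := fun l hl => by
    rw [List.Nodup, List.pairwise_map] at hl ⊢
    exact hl.imp fun hne he => hne (by simpa [liftPerfectColour] using he)
  rintro ⟨a, b, e⟩
  obtain ⟨l, -, hl3, hnd, rfl⟩ := H a
  rw [List.map_id] at hnd
  rcases l with _ | ⟨i, _ | ⟨j, _ | ⟨k, _ | ⟨m, l⟩⟩⟩⟩
  · rcases eq_zero_or_exists_unit b with rfl | ⟨w, rfl⟩
    · obtain ⟨l, h2, h3, hn, rfl⟩ := hu' e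
      refine ⟨l.map fun j => .inr (.inr j), by simpa, by simpa, ?_, ?_⟩
      · rw [List.map_map]; exact hcol l hn
      · rw [List.map_map]; exact hsum l
    · obtain ⟨l, -, h2, hn, rfl⟩ := hu e
      rcases l with _ | ⟨j, l⟩
      · obtain ⟨w₁, w₂, hw, hne⟩ := hS w
        exact ⟨[.inr (.inl w₁), .inr (.inl w₂)], by simp, by simp,
          by simp [liftPerfectColour, hne], by simp [liftPerfect, hw]⟩
      · refine ⟨.inr (.inl w) :: (j :: l).map fun j => .inr (.inr j), by simp, ?_, ?_, ?_⟩
        · simp at h2 ⊢; omega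
        · rw [List.map_cons, List.map_map, List.nodup_cons]
          exact ⟨by simp [liftPerfectColour], hcol _ hn⟩
        · rw [List.map_cons, List.map_map, List.sum_cons]
          have := hsum (j :: l)
          simp only [Function.comp_def] at this ⊢
          rw [this]
          simp [liftPerfect]
  · obtain ⟨l, -, h2, hn, hle⟩ := hu (e - (κ i * b, κ i ^ 2 * b))
    rcases l with _ | ⟨j, l⟩
    · obtain ⟨δ, j, hj⟩ := hhit i
      refine ⟨[.inl (i, b + δ), .inr (.inl δ), .inr (.inr j)], by simp, by simp,
        by simp [liftPerfectColour], ?_⟩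
      have h1 : b + δ + δ = b := by rw [add_assoc, CharTwo.add_self_eq_zero, add_zero]
      have h3 : ∀ t : K, t * (b + δ) + t * δ = t * b := fun t => by rw [← mul_add, h1]
      have h4 : e = (κ i * b, κ i ^ 2 * b) := (sub_eq_zero.1 hle.symm)
      simp [liftPerfect, hj, h1, h3, h4]
    · refine ⟨.inl (i, b) :: (j :: l).map fun j => .inr (.inr j), by simp, ?_, ?_, ?_⟩
      · simp at h2 ⊢; omega
      · rw [List.map_cons, List.map_map, List.nodup_cons]
        exact ⟨by simp [liftPerfectColour], hcol _ hn⟩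
      · rw [List.map_cons, List.map_map, List.sum_cons]
        have := hsum (j :: l)
        simp only [Function.comp_def] at this ⊢
        rw [this, hle]
        simp [liftPerfect]
  · have hne : i ≠ j := by simpa using hnd
    obtain ⟨c, d⟩ := e
    -- the last two coordinates form a Vandermonde system in `κ i * x` and `κ j * y`
    obtain ⟨x', y', h1, h2⟩ := exists_vandermonde_two (hκ.ne hne) c d
    obtain ⟨x, rfl⟩ : ∃ x, x' = κ i * x := ⟨x' / κ i, (mul_div_cancel₀ _ (hκ0 i)).symm⟩
    obtain ⟨y, rfl⟩ : ∃ y, y' = κ j * y := ⟨y' / κ j, (mul_div_cancel₀ _ (hκ0 j)).symm⟩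
    rw [← mul_assoc, ← mul_assoc, ← sq, ← sq] at h2
    rcases eq_zero_or_exists_unit (b - (x + y)) with h0 | ⟨w, hw⟩
    · exact ⟨[.inl (i, x), .inl (j, y)], by simp, by simp, by simp [liftPerfectColour, hne],
        by simp [liftPerfect, h1, h2, sub_eq_zero.1 h0]⟩
    · exact ⟨[.inl (i, x), .inl (j, y), .inr (.inl w)], by simp, by simp,
        by simp [liftPerfectColour, hne], by simp [liftPerfect, h1, h2, hw]; ring⟩
  · obtain ⟨c, d⟩ := e
    have hnd' : [κ i, κ j, κ k].Nodup := by simpa using hnd.map hκ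
    obtain ⟨x, y, z, h1, h2, h3⟩ := exists_vandermonde_three hnd' b c d
    simp only [List.nodup_cons, List.mem_cons,
      List.not_mem_nil, or_false, not_or, not_false_eq_true, List.nodup_nil, and_true] at hnd
    exact ⟨[.inl (i, x), .inl (j, y), .inl (k, z)], by simp, by simp,
      by simp [liftPerfectColour, hnd], by simp [liftPerfect, h1, h2, h3]⟩
  · simp at hl3; omega

end Lift

/-! ### The field with `32` elements -/

/-- The field with `32` elements. -/
abbrev F32 : Type := GaloisField 2 5

lemma natCard_F32 : Nat.card F32 = 32 := by
  simpa using GaloisField.card 2 5 (by norm_num)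

/-- A root of `X ^ 5 + X ^ 2 + 1` exists: this polynomial divides `X ^ 31 - 1`, and the cofactor
has only degree `26`. -/
lemma exists_F32_root : ∃ α : F32, α ^ 5 = α ^ 2 + 1 := by
  classical
  have : Finite F32 := Nat.finite_of_card_ne_zero (by rw [natCard_F32]; norm_num)
  have : Fintype F32 := Fintype.ofFinite F32
  by_contra! hα
  have h2 : (2 : F32) = 0 := CharTwo.two_eq_zero
  have hcard : Fintype.card F32 = 32 := by rw [← Nat.card_eq_fintype_card, natCard_F32]
  let g : Polynomial F32 := .X ^ 26 + .X ^ 23 + .X ^ 21 + .X ^ 20 + .X ^ 17 + .X ^ 16 + .X ^ 15 +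
    .X ^ 14 + .X ^ 13 + .X ^ 9 + .X ^ 8 + .X ^ 6 + .X ^ 5 + .X ^ 4 + .X ^ 2 + 1
  have hdeg : g.natDegree = 26 := by simp only [g]; compute_degree!
  have hg0 : g ≠ 0 := fun h => by rw [h] at hdeg; simp at hdeg
  have hsub : (Finset.univ.erase (0 : F32)) ⊆ g.roots.toFinset := fun x hx => by
    have hx0 : x ≠ 0 := Finset.ne_of_mem_erase hx
    have hx31 : x ^ 31 = 1 := by
      have := FiniteField.pow_card_sub_one_eq_one x hx0
      rwa [hcard] at this
    rw [Multiset.mem_toFinset, Polynomial.mem_roots hg0, Polynomial.IsRoot.def]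
    have hmul : (x ^ 5 + x ^ 2 + 1) * g.eval x = 0 := by
      simp only [g, Polynomial.eval_add, Polynomial.eval_pow, Polynomial.eval_X,
        Polynomial.eval_one]
      linear_combination hx31 + (1 + x ^ 28 + x ^ 26 + x ^ 25 + x ^ 23 + x ^ 22 + x ^ 21 +
        x ^ 20 + x ^ 19 + x ^ 18 + x ^ 17 + x ^ 16 + x ^ 15 + x ^ 14 + x ^ 13 + x ^ 11 + x ^ 10 +
        x ^ 9 + x ^ 8 + x ^ 7 + x ^ 6 + x ^ 5 + x ^ 4 + x ^ 2) * h2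
    rcases mul_eq_zero.1 hmul with h | h
    · refine absurd ?_ (hα x)
      linear_combination h - (x ^ 2 + 1) * h2
    · exact h
  have h1 := (Finset.card_le_card hsub).trans (Multiset.toFinset_card_le _)
  have h3 := g.card_roots'
  rw [Finset.card_erase_of_mem (Finset.mem_univ _), Finset.card_univ, hcard] at h1
  omega

/-- Multiplication by `α` in the basis `1, α, …, α ^ 4`, where `α ^ 5 = α ^ 2 + 1`. -/
def mulAlpha (v : BinVec 5) : BinVec 5 := ![v 4, v 0, v 1 + v 4, v 2, v 3]

/-- The element with coordinates `v` in the basis `1, α, …, α ^ 4`. -/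
noncomputable def evalAlpha (α : F32) : BinVec 5 →ₗ[ZMod 2] F32 :=
  Fintype.linearCombination (ZMod 2) fun i : Fin 5 => α ^ (i : ℕ)

section Alpha

variable {α : F32}

lemma evalAlpha_mulAlpha (hα : α ^ 5 = α ^ 2 + 1) (v : BinVec 5) :
    evalAlpha α (mulAlpha v) = α * evalAlpha α v := by
  simp only [evalAlpha, Fintype.linearCombination_apply, Fin.sum_univ_five, mulAlpha,
    Algebra.smul_def, Matrix.cons_val, map_add, Fin.isValue]
  norm_num
  linear_combination - (algebraMap (ZMod 2) F32 (v 4)) * hα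

lemma evalAlpha_iterate (hα : α ^ 5 = α ^ 2 + 1) (k : ℕ) :
    evalAlpha α (mulAlpha^[k] ![1, 0, 0, 0, 0]) = α ^ k := by
  induction k with
  | zero => simp [evalAlpha, Fintype.linearCombination_apply, Fin.sum_univ_five]
  | succ k ih => rw [Function.iterate_succ_apply', evalAlpha_mulAlpha hα, ih, pow_succ']

lemma alpha_ne_zero (hα : α ^ 5 = α ^ 2 + 1) : α ≠ 0 := by
  rintro rfl
  norm_num at hα

lemma evalAlpha_injective (hα : α ^ 5 = α ^ 2 + 1) : Function.Injective (evalAlpha α) := by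
  rw [injective_iff_map_eq_zero]
  intro v hv
  by_contra h0
  have hpow : ∀ v : BinVec 5, v ≠ 0 → ∃ k : Fin 31, mulAlpha^[k] ![1, 0, 0, 0, 0] = v := by
    decide +kernel
  obtain ⟨k, rfl⟩ := hpow v h0
  rw [evalAlpha_iterate hα] at hv
  exact pow_ne_zero _ (alpha_ne_zero hα) hv

lemma orderOf_alpha (hα : α ^ 5 = α ^ 2 + 1) : orderOf α = 31 := by
  have : Finite F32 := Nat.finite_of_card_ne_zero (by rw [natCard_F32]; norm_num)
  have : Fintype F32 := Fintype.ofFinite F32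
  have : Fact (Nat.Prime 31) := ⟨by norm_num⟩
  refine orderOf_eq_prime ?_ ?_
  · have := FiniteField.pow_card_sub_one_eq_one α (alpha_ne_zero hα)
    rwa [← Nat.card_eq_fintype_card, natCard_F32] at this
  · rintro rfl
    rw [one_pow, one_pow, CharTwo.add_self_eq_zero] at hα
    exact one_ne_zero hα

/-- The coordinates `0, …, 4` and `5, …, 9`, read as elements of the field. -/
noncomputable def evalAlphaPair (α : F32) : BinVec 10 →ₗ[ZMod 2] F32 × F32 :=
  ((evalAlpha α).comp (LinearMap.funLeft (ZMod 2) (ZMod 2) (Fin.castAdd 5))).prod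
    ((evalAlpha α).comp (LinearMap.funLeft (ZMod 2) (ZMod 2) (Fin.natAdd 5)))

lemma evalAlphaPair_injective (hα : α ^ 5 = α ^ 2 + 1) :
    Function.Injective (evalAlphaPair α) := by
  intro v w h
  have h1 := evalAlpha_injective hα (congrArg Prod.fst h)
  have h2 := evalAlpha_injective hα (congrArg Prod.snd h)
  funext i
  refine Fin.addCases (m := 5) (n := 5) (motive := fun i => v i = w i) (fun i => ?_)
    (fun i => ?_) i
  · exact congrFun h1 i
  · exact congrFun h2 i

lemma evalAlphaPair_surjective (hα : α ^ 5 = α ^ 2 + 1) :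
    Function.Surjective (evalAlphaPair α) := by
  have : Finite F32 := Nat.finite_of_card_ne_zero (by rw [natCard_F32]; norm_num)
  have : Fintype F32 := Fintype.ofFinite F32
  refine ((Fintype.bijective_iff_injective_and_card _).2 ⟨evalAlphaPair_injective hα, ?_⟩).2
  rw [Fintype.card_prod, ← Nat.card_eq_fintype_card (α := F32), natCard_F32]
  simp [ZMod.card]

end Alpha

/-! ### Partitions of the field used as colourings -/

/-- Every unit is a sum of two units from different parts: take three units in the first part. -/
lemma exists_partition_two {K : Type*} [Field K] [CharP K 2] {p q r : K} (hp : p ≠ 0) (hq : q ≠ 0)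
    (hr : r ≠ 0) (hpq : p ≠ q) (hpr : p ≠ r) (hqr : q ≠ r) (hpqr : p + q ≠ r) :
    ∃ S : Kˣ → Bool, ∀ w : Kˣ, ∃ w₁ w₂ : Kˣ, (w₁ + w₂ : K) = w ∧ S w₁ ≠ S w₂ := by
  classical
  refine ⟨fun w => decide ((w : K) = p ∨ (w : K) = q ∨ (w : K) = r), fun w => ?_⟩
  suffices ∃ x y : K, x ≠ 0 ∧ y ≠ 0 ∧ x + y = w ∧ (x = p ∨ x = q ∨ x = r) ∧
      y ≠ p ∧ y ≠ q ∧ y ≠ r by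
    obtain ⟨x, y, hx, hy, hxy, h1, h2⟩ := this
    exact ⟨Units.mk0 x hx, Units.mk0 y hy, hxy, by simp [h1, h2]⟩
  have hw := w.ne_zero
  generalize (w : K) = w at hw
  have h2 : (2 : K) = 0 := CharTwo.two_eq_zero
  rcases eq_or_ne w p with rfl | h3
  · exact ⟨q, w + q, by grind⟩
  rcases eq_or_ne w q with rfl | h4
  · exact ⟨p, p + w, by grind⟩
  rcases eq_or_ne w r with rfl | h5
  · exact ⟨p, p + w, by grind⟩
  rcases eq_or_ne w (p + q) with rfl | h6
  · exact ⟨r, r + (p + q), by grind⟩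
  rcases eq_or_ne w (p + r) with rfl | h7
  · exact ⟨q, q + (p + r), by grind⟩
  · exact ⟨p, p + w, by grind⟩

/-- Every element is a sum of elements of the three parts `{0, q}`, `{p, r}` and the rest. -/
lemma exists_partition_three {K : Type*} [Field K] [CharP K 2] {p q r : K} (hp : p ≠ 0)
    (hq : q ≠ 0) (hr : r ≠ 0)
    (hpq : p ≠ q) (hpr : p ≠ r) (hqr : q ≠ r) (hpqr : p + q ≠ r) :
    ∃ S : K → Fin 3, ∀ ξ, ∃ a b c, a + (b + c) = ξ ∧ S a = 0 ∧ S b = 1 ∧ S c = 2 := by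
  classical
  refine ⟨fun x => if x = 0 ∨ x = q then 0 else if x = p ∨ x = r then 1 else 2, fun ξ => ?_⟩
  suffices ∃ a b c : K, a + (b + c) = ξ ∧ (a = 0 ∨ a = q) ∧ (b = p ∨ b = r) ∧ c ≠ 0 ∧ c ≠ q ∧
      c ≠ p ∧ c ≠ r by
    obtain ⟨a, b, c, h, h1, h2, h3, h4, h5, h6⟩ := this
    refine ⟨a, b, c, h, by simp [h1], ?_, by simp [h3, h4, h5, h6]⟩
    rcases h2 with rfl | rfl
    · simp [hp, hpq]
    · simp [hr, hqr.symm]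
  have h2 : (2 : K) = 0 := CharTwo.two_eq_zero
  rcases eq_or_ne ξ p with rfl | h3
  · exact ⟨0, r, ξ + r, by grind⟩
  rcases eq_or_ne ξ (p + q) with rfl | h4
  · exact ⟨0, r, p + q + r, by grind⟩
  rcases eq_or_ne ξ 0 with rfl | h5
  · exact ⟨q, p, p + q, by grind⟩
  rcases eq_or_ne ξ (p + r) with rfl | h6
  · exact ⟨q, r, p + q, by grind⟩
  · exact ⟨0, p, ξ + p, by grind⟩

/-! ### Three short codes -/

/-- There are `n` columns in a space of dimension `r` over the field with two elements, coloured
with at most `p` colours, that form a coloured cover and belong to a code of minimum distance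
`3`. -/
def HasColumns (n r ℓ R p : ℕ) : Prop :=
  ∃ (ι V C : Type) (_ : Finite ι) (_ : AddCommGroup V) (_ : Module (ZMod 2) V) (_ : Finite C)
    (h : ι → V) (κ : ι → C), Nat.card ι = n ∧ Nat.card V = 2 ^ r ∧ Nat.card C ≤ p ∧
    IsDistanceThree h ∧ ColouredCovers h κ ℓ R

section Lists

variable {cs : List (List ℕ)} {r : ℕ}

lemma bitVec_snd_injective (h1 : ∀ p ∈ colouredColumns cs, p.2 < 2 ^ r)
    (h2 : ((colouredColumns cs).map Prod.snd).Nodup) :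
    Function.Injective fun p : {p // p ∈ colouredColumns cs} => bitVec r p.1.2 := fun p q h =>
  Subtype.ext (List.inj_on_of_nodup_map h2 p.2 q.2 (bitVec_inj (h1 p p.2) (h1 q q.2) h))

lemma bitVec_snd_ne_zero (h1 : ∀ p ∈ colouredColumns cs, p.2 < 2 ^ r)
    (h0 : ∀ p ∈ colouredColumns cs, p.2 ≠ 0) (p : {p // p ∈ colouredColumns cs}) :
    bitVec r p.1.2 ≠ 0 := fun h =>
  h0 p p.2 (bitVec_inj (h1 p p.2) (by positivity) (h.trans (bitVec_zero r).symm))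

lemma natCard_colouredColumns (h2 : ((colouredColumns cs).map Prod.snd).Nodup) :
    Nat.card {p // p ∈ colouredColumns cs} = (colouredColumns cs).length := by
  classical
  have h3 : (colouredColumns cs).Nodup := List.Nodup.of_map _ h2
  rw [Nat.card_eq_fintype_card, Fintype.card_of_subtype (colouredColumns cs).toFinset (by simp),
    List.toFinset_card_of_nodup h3]

end Lists

/-- The columns of a `[51, 41]` code of covering radius `2`, in `16` colour classes; binary digits
are coordinates. -/
def columns51 : List (List ℕ) :=
  [[10, 407, 750, 992], [172, 688, 823], [54, 516], [299, 303, 381, 819], [27, 250, 1013],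
    [168, 692], [153], [274, 560, 843, 966], [271, 737], [187, 490], [333, 448, 701],
    [260, 359, 542, 637, 883], [112, 356, 788], [111, 139, 264, 742, 776, 871], [500, 650, 926],
    [266, 357, 514, 621]]

/-- The columns `x ^ i` modulo `x ^ 11 + x ^ 10 + x ^ 6 + x ^ 5 + x ^ 4 + x ^ 2 + 1` of the binary
Golay code of length `23`, each with its own colour. -/
def columnsGolay : List (List ℕ) :=
  [[1], [2], [4], [8], [16], [32], [64], [128], [256], [512], [1024], [1141], [1183], [1355],
    [1763], [435], [870], [1740], [493], [986], [1972], [797], [1594]]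

/-- The columns of a `[90, 70]` code of covering radius `4`, in `31` colour classes. The last
`18` columns live in the lower `12` digits, which stand for a space of dimension `4` over the
field with `8` elements. The others are the multiples of the nine points of the twisted cubic in
that space, with the columns of the repetition code of length `9` in the upper `8` digits. -/
def columns90 : List (List ℕ) :=
  [[4096], [4097, 4098, 4099, 4100, 4101, 4102, 4103], [8192],
    [8777, 9362, 9947, 10532, 11117, 11702, 12287], [16384],
    [18193, 19682, 19443, 20380, 18573, 17278, 17519], [32768],
    [35161, 34418, 36651, 36028, 34277, 35534, 33687], [65536],
    [68513, 66522, 67707, 66932, 69333, 67246, 68879], [131072],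
    [134633, 134986, 131747, 133716, 133053, 132382, 133367], [262144],
    [265905, 265018, 263563, 262892, 265309, 264662, 264039], [524288],
    [525561, 526762, 527699, 526284, 525109, 527974, 527007], [1044480],
    [1044992, 1045504, 1046016, 1046528, 1047040, 1047552, 1048064], [19, 42], [5], [1], [2],
    [3], [466], [31, 100], [38], [57], [12, 274], [7, 6], [4], [53, 145]]

lemma columns51_lt : ∀ p ∈ colouredColumns columns51, p.2 < 2 ^ 10 := by decide
lemma columns51_ne_zero : ∀ p ∈ colouredColumns columns51, p.2 ≠ 0 := by decide
lemma columns51_nodup : ((colouredColumns columns51).map Prod.snd).Nodup := by decide +kernel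
lemma columnsGolay_lt : ∀ p ∈ colouredColumns columnsGolay, p.2 < 2 ^ 11 := by decide
lemma columnsGolay_ne_zero : ∀ p ∈ colouredColumns columnsGolay, p.2 ≠ 0 := by decide
lemma columnsGolay_nodup : ((colouredColumns columnsGolay).map Prod.snd).Nodup := by
  decide +kernel
lemma columns90_lt : ∀ p ∈ colouredColumns columns90, p.2 < 2 ^ 20 := by decide +kernel
lemma columns90_ne_zero : ∀ p ∈ colouredColumns columns90, p.2 ≠ 0 := by decide +kernel
lemma columns90_nodup : ((colouredColumns columns90).map Prod.snd).Nodup := by decide +kernel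

lemma isFull_columns51 : isFull 10 0 2 columns51 = true := by decide +kernel
lemma isFull_columns51' : isFull 10 2 3 columns51 = true := by decide +kernel
lemma isFull_columnsGolay : isFull 11 0 3 columnsGolay = true := by decide +kernel
lemma isFull_columns90 : isFull 20 2 4 columns90 = true := by decide +kernel

/-! ### Codes of codimension `26` and `40` -/

/-- Triples `(x, a, b)` such that the column `x` of the code of length `51` is, in the coordinates
of `evalAlphaPair`, the pair `(α ^ a, α ^ (a + b))`. -/
def powerColumns : List (ℕ × ℕ × ℕ) :=
  [(54, 28, 3), (111, 23, 26), (112, 4, 14), (139, 27, 6), (153, 25, 8), (168, 3, 2),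
    (172, 20, 16), (187, 16, 20), (260, 2, 1), (264, 3, 0), (266, 6, 28), (271, 23, 11),
    (274, 30, 4), (333, 8, 29), (356, 2, 25), (357, 5, 22), (381, 14, 13), (490, 6, 17),
    (621, 8, 9), (688, 4, 18), (692, 7, 15), (742, 19, 7), (823, 26, 30)]

/-- The exponents `b` in `powerColumns`, one for each column of the Golay code. -/
def powerExponent (i : ℕ) : ℕ := (powerColumns.getD i (0, 0, 0)).2.2

lemma powerColumns_spec : ∀ i < 23, ∃ x a, (powerColumns.getD i (0, 0, 0)) =
    (x, a, powerExponent i) ∧ (∃ p ∈ colouredColumns columns51, p.2 = x) ∧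
    (fun j : Fin 5 => bitVec 10 x (Fin.castAdd 5 j)) = mulAlpha^[a] ![1, 0, 0, 0, 0] ∧
    (fun j : Fin 5 => bitVec 10 x (Fin.natAdd 5 j)) =
      mulAlpha^[a + powerExponent i] ![1, 0, 0, 0, 0] := by
  have h : ∀ d ∈ powerColumns, (∃ p ∈ colouredColumns columns51, p.2 = d.1) ∧
      (fun j : Fin 5 => bitVec 10 d.1 (Fin.castAdd 5 j)) = mulAlpha^[d.2.1] ![1, 0, 0, 0, 0] ∧
      (fun j : Fin 5 => bitVec 10 d.1 (Fin.natAdd 5 j)) =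
        mulAlpha^[d.2.1 + d.2.2] ![1, 0, 0, 0, 0] := by
    decide +kernel
  intro i hi
  have hmem : powerColumns.getD i (0, 0, 0) ∈ powerColumns := by
    rw [List.getD_eq_getElem _ _ (by simpa [powerColumns] using hi)]
    exact List.getElem_mem _
  exact ⟨_, _, rfl, h _ hmem⟩

lemma powerExponent_lt : ∀ i < 23, powerExponent i < 31 := by decide

lemma powerExponent_injOn : ∀ i < 23, ∀ j < 23, powerExponent i = powerExponent j → i = j := by
  decide

lemma alpha_sq_ne {α : F32} (hα : α ^ 5 = α ^ 2 + 1) : 1 + α ≠ α ^ 2 := fun h => by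
  have h2 : (2 : F32) = 0 := CharTwo.two_eq_zero
  have h0 := alpha_ne_zero hα
  have h3 : α ^ 3 = 1 := by linear_combination (-α - 1) * h + α * h2
  have h4 : α ^ 5 = α ^ 2 := by linear_combination α ^ 2 * h3
  rw [h4] at hα
  exact one_ne_zero (left_eq_add.1 hα)

lemma alpha_ne_one {α : F32} (hα : α ^ 5 = α ^ 2 + 1) : 1 ≠ α := by
  rintro rfl
  rw [one_pow, one_pow, CharTwo.add_self_eq_zero] at hα
  exact one_ne_zero hα

lemma one_ne_alpha_sq {α : F32} (hα : α ^ 5 = α ^ 2 + 1) : 1 ≠ α ^ 2 := fun h =>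
  alpha_ne_one hα (CharTwo.sq_injective (by simpa using h))

lemma alpha_ne_alpha_sq {α : F32} (hα : α ^ 5 = α ^ 2 + 1) : α ≠ α ^ 2 := fun h =>
  alpha_ne_one hα (mul_left_cancel₀ (alpha_ne_zero hα) (by rw [mul_one, ← sq]; exact h.symm)).symm

theorem hasColumns_818 : HasColumns 818 26 2 3 64 := by
  have : Finite F32 := Nat.finite_of_card_ne_zero (by rw [natCard_F32]; norm_num)
  obtain ⟨α, hα⟩ := exists_F32_root
  have hα0 := alpha_ne_zero hα
  obtain ⟨S, hS⟩ := exists_partition_two one_ne_zero hα0 (pow_ne_zero 2 hα0) (alpha_ne_one hα)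
    (one_ne_alpha_sq hα) (alpha_ne_alpha_sq hα) (alpha_sq_ne hα)
  let I := {p // p ∈ colouredColumns columnsGolay}
  let J := {p // p ∈ colouredColumns columns51}
  let g : I → BinVec 11 := fun p => bitVec 11 p.1.2
  let β : I → F32 := fun p => α ^ powerExponent p.1.1
  let u : J → F32 × F32 := fun p => evalAlphaPair α (bitVec 10 p.1.2)
  let κ : J → Fin 16 := fun p => ⟨p.1.1, fst_lt_of_mem_colouredColumns p.2⟩
  have hI : ∀ p q : I, p.1.1 = q.1.1 → p = q := fun p q h =>
    Subtype.ext (List.inj_on_of_nodup_map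
      (show ((colouredColumns columnsGolay).map Prod.fst).Nodup by decide +kernel) p.2 q.2 h)
  have hlt : ∀ p : I, p.1.1 < 23 := fun p => fst_lt_of_mem_colouredColumns p.2
  have hg : ColouredCovers g (id : I → I) 0 3 :=
    (colouredCovers_of_isFull columnsGolay_lt isFull_columnsGolay).refine
      fun i j h => by rw [show i = j from h]
  have hu : ∀ ℓ R, isFull 10 ℓ R columns51 = true → ColouredCovers u κ ℓ R := by
    intro ℓ R hfull e
    obtain ⟨v, rfl⟩ := evalAlphaPair_surjective hα e
    obtain ⟨l, h1, h2, h3, h4⟩ := (colouredCovers_of_isFull columns51_lt hfull).refine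
      (κ' := κ) (fun i j h => congrArg Fin.val h) v
    refine ⟨l, h1, h2, h3, ?_⟩
    rw [← h4, map_list_sum, List.map_map]
    rfl
  have hβ : Function.Injective β := fun p q h => by
    refine hI p q (powerExponent_injOn _ (hlt p) _ (hlt q) ?_)
    have hord := orderOf_alpha hα
    exact pow_injOn_Iio_orderOf (by simpa [hord] using powerExponent_lt _ (hlt p))
      (by simpa [hord] using powerExponent_lt _ (hlt q)) h
  have hu0 : ∀ j, u j ≠ 0 := fun j h =>
    bitVec_snd_ne_zero columns51_lt columns51_ne_zero j
      (evalAlphaPair_injective hα (h.trans (map_zero _).symm))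
  have hui : Function.Injective u :=
    (evalAlphaPair_injective hα).comp (bitVec_snd_injective columns51_lt columns51_nodup)
  have hhit : ∀ i, ∃ (δ : F32ˣ) (j : J), u j = (β i * δ, β i ^ 2 * δ) := by
    intro i
    obtain ⟨x, a, -, ⟨p, hp, rfl⟩, h1, h2⟩ := powerColumns_spec _ (hlt i)
    have hβ0 : β i ≠ 0 := pow_ne_zero _ hα0
    refine ⟨Units.mk0 (α ^ a / β i) (div_ne_zero (pow_ne_zero _ hα0) hβ0), ⟨p, hp⟩, ?_⟩
    refine Prod.ext ?_ ?_
    · have : (u ⟨p, hp⟩).1 = α ^ a := by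
        rw [← evalAlpha_iterate hα, ← h1]; rfl
      rw [this, Units.val_mk0, mul_div_cancel₀ _ hβ0]
    · have : (u ⟨p, hp⟩).2 = α ^ a * β i := by
        rw [← pow_add, ← evalAlpha_iterate hα, ← h2]; rfl
      rw [this, Units.val_mk0]
      field_simp
  refine ⟨(I × F32) ⊕ F32ˣ ⊕ J, BinVec 11 × F32 × F32 × F32, I ⊕ Bool ⊕ Fin 16,
    inferInstance, inferInstance, inferInstance, inferInstance, liftPerfect g β u,
    liftPerfectColour S κ, ?_, ?_, ?_, ?_, ?_⟩
  · have h1 : Nat.card I = 23 := natCard_colouredColumns columnsGolay_nodup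
    have h2 : Nat.card J = 51 := natCard_colouredColumns columns51_nodup
    rw [Nat.card_sum, Nat.card_sum, Nat.card_prod, Nat.card_units, natCard_F32, h1, h2]
  · simp only [Nat.card_prod, natCard_F32]
    simp [Nat.card_eq_fintype_card, ZMod.card]
  · have h1 : Nat.card I = 23 := natCard_colouredColumns columnsGolay_nodup
    rw [Nat.card_sum, Nat.card_sum, h1]
    simp
  · exact isDistanceThree_liftPerfect (by rw [natCard_F32]; norm_num)
      (bitVec_snd_injective columnsGolay_lt columnsGolay_nodup)
      (bitVec_snd_ne_zero columnsGolay_lt columnsGolay_ne_zero) hui hu0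
  · exact colouredCovers_liftPerfect hg hβ (fun i => pow_ne_zero _ hα0)
      (hu 0 2 isFull_columns51) (hu 2 3 isFull_columns51') hS hhit

theorem hasColumns_2942 : HasColumns 2942 40 3 4 128 := by
  have : Finite F32 := Nat.finite_of_card_ne_zero (by rw [natCard_F32]; norm_num)
  obtain ⟨α, hα⟩ := exists_F32_root
  have hα0 := alpha_ne_zero hα
  obtain ⟨S, hS⟩ := exists_partition_three one_ne_zero hα0 (pow_ne_zero 2 hα0) (alpha_ne_one hα)
    (one_ne_alpha_sq hα) (alpha_ne_alpha_sq hα) (alpha_sq_ne hα)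
  let I := {p // p ∈ colouredColumns columns90}
  obtain ⟨e⟩ : Nonempty (Fin 32 ≃ F32) := ⟨(Finite.equivFinOfCardEq natCard_F32).symm⟩
  let κ : I → F32 := fun p => e ⟨p.1.1, (fst_lt_of_mem_colouredColumns p.2).trans
    (show columns90.length < 32 by decide)⟩
  have hcov := (colouredCovers_of_isFull columns90_lt isFull_columns90).refine (κ' := κ)
    fun i j h => by simpa [κ] using h
  refine ⟨(I × F32) ⊕ F32ˣ ⊕ F32ˣ, BinVec 20 × F32 × F32 × F32 × F32, (F32 × Fin 3) ⊕ Bool,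
    inferInstance, inferInstance, inferInstance, inferInstance, liftFourTwice _ κ,
    liftFourTwiceColour κ S, ?_, ?_, ?_, isDistanceThree_liftFourTwice
      (by rw [natCard_F32]; norm_num) (bitVec_snd_injective columns90_lt columns90_nodup)
      (bitVec_snd_ne_zero columns90_lt columns90_ne_zero),
    colouredCovers_liftFourTwice hcov hS⟩
  · have h1 : Nat.card I = 90 := natCard_colouredColumns columns90_nodup
    rw [Nat.card_sum, Nat.card_sum, Nat.card_prod, Nat.card_units, natCard_F32, h1]
  · simp only [Nat.card_prod, natCard_F32]
    simp [Nat.card_eq_fintype_card, ZMod.card]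
  · rw [Nat.card_sum, Nat.card_prod, natCard_F32]
    simp

/-! ### The family of covering radius `2` -/

/-- There are `n` columns in a space of dimension `r` over the field with two elements, coloured
with at most `p` colours, that form a coloured cover for radius `2`, belong to a code of minimum
distance `3`, and contain `h i + h j = h k` with `h i` and `h j` of different colours. -/
def HasTwoColumns (n r p : ℕ) : Prop :=
  ∃ (ι V C : Type) (_ : Finite ι) (_ : AddCommGroup V) (_ : Module (ZMod 2) V) (_ : Finite C)
    (h : ι → V) (κ : ι → C), Nat.card ι = n ∧ Nat.card V = 2 ^ r ∧ Nat.card C ≤ p ∧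
    Function.Injective h ∧ (∀ i, h i ≠ 0) ∧ ColouredCovers h κ 0 2 ∧
    ∃ i j k, h i + h j = h k ∧ κ i ≠ κ j

lemma HasTwoColumns.mono {n r p q : ℕ} (H : HasTwoColumns n r p) (hpq : p ≤ q) :
    HasTwoColumns n r q := by
  obtain ⟨ι, V, C, _, _, _, _, h, κ, h1, h2, h3, h4⟩ := H
  exact ⟨ι, V, C, ‹_›, ‹_›, ‹_›, ‹_›, h, κ, h1, h2, h3.trans hpq, h4⟩

/-- A colouring can be refined so that exactly the elements of `K` are the colours in use. -/
lemma exists_surjective_refinement {ι C K : Type*} [Finite ι] [Finite C] [Finite K] (κ : ι → C)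
    (hC : Nat.card C ≤ Nat.card K) (hι : Nat.card K ≤ Nat.card ι) :
    ∃ κ' : ι → K, Function.Surjective κ' ∧ ∀ i j, κ' i = κ' j → κ i = κ j := by
  classical
  have : Fintype ι := Fintype.ofFinite ι
  -- a set `T` of representatives of the colours, enlarged to have as many elements as `K`
  choose t ht using fun c : Set.range κ => c.2
  let T₀ : Finset ι := Finset.univ.image fun i => t ⟨κ i, i, rfl⟩
  have hT₀ : T₀.card ≤ Nat.card K := by
    have : Fintype C := Fintype.ofFinite C
    refine le_trans ?_ hC
    rw [Nat.card_eq_fintype_card, ← Finset.card_univ]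
    refine Finset.card_le_card_of_injOn κ (fun _ _ => Finset.mem_coe.2 (Finset.mem_univ _)) ?_
    intro i hi j hj hij
    obtain ⟨i, -, rfl⟩ := Finset.mem_image.1 (Finset.mem_coe.1 hi)
    obtain ⟨j, -, rfl⟩ := Finset.mem_image.1 (Finset.mem_coe.1 hj)
    simp only [ht] at hij
    simp only [hij]
  obtain ⟨T, hT₁, -, hT₂⟩ := Finset.exists_subsuperset_card_eq (Finset.subset_univ T₀) hT₀
    (by rwa [Finset.card_univ, ← Nat.card_eq_fintype_card])
  have hT : ∀ i, t ⟨κ i, i, rfl⟩ ∈ T := fun i =>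
    hT₁ (Finset.mem_image_of_mem _ (Finset.mem_univ i))
  let g : ι → T := fun i => if hi : i ∈ T then ⟨i, hi⟩ else ⟨_, hT i⟩
  have hg : ∀ i, κ (g i) = κ i := fun i => by
    by_cases hi : i ∈ T
    · simp [g, hi]
    · simpa [g, hi] using ht ⟨κ i, i, rfl⟩
  obtain ⟨e⟩ : Nonempty (T ≃ K) :=
    ⟨(Finite.equivFinOfCardEq (by simpa using hT₂)).trans (Finite.equivFin K).symm⟩
  refine ⟨fun i => e (g i), fun b => ⟨(e.symm b : ι), ?_⟩, fun i j hij => ?_⟩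
  · have : g (e.symm b : ι) = e.symm b := by simp [g]
    simp [this]
  · rw [← hg i, ← hg j, e.injective hij]

theorem HasTwoColumns.lift {n r p m : ℕ} (H : HasTwoColumns n r p) (hm : m ≠ 0) (hp : p ≤ 2 ^ m)
    (hn : 2 ^ m ≤ n) : HasTwoColumns (n * 2 ^ m + (2 ^ m - 1)) (r + 2 * m) (2 ^ (m + 1)) := by
  classical
  obtain ⟨ι, V, C, _, _, _, _, h, κ₀, rfl, hV, hC, hi, h0, hcov, i₁, i₂, i₃, h₃, h₁₂⟩ := H
  have hK : Nat.card (GaloisField 2 m) = 2 ^ m := GaloisField.card 2 m hm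
  have : Finite (GaloisField 2 m) := Nat.finite_of_card_ne_zero (by rw [hK]; positivity)
  obtain ⟨κ, hκs, hκ⟩ := exists_surjective_refinement (K := GaloisField 2 m) κ₀
    (by rw [hK]; exact hC.trans hp) (by rwa [hK])
  replace h₁₂ : κ i₁ ≠ κ i₂ := fun h => h₁₂ (hκ _ _ h)
  obtain ⟨s₀, hs₀⟩ := hκs.hasRightInverse
  let s := Function.update (Function.update s₀ (κ i₁) i₁) (κ i₂) i₂
  have hs₁ : s (κ i₁) = i₁ := by simp [s, h₁₂]
  have hs₂ : s (κ i₂) = i₂ := by simp [s]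
  have hs : ∀ b, κ (s b) = b := fun b => by
    by_cases h2 : b = κ i₂
    · rw [h2, hs₂]
    by_cases h1 : b = κ i₁
    · rw [h1, hs₁]
    simpa [s, h1, h2] using hs₀ b
  refine ⟨(ι × GaloisField 2 m) ⊕ (GaloisField 2 m)ˣ, V × GaloisField 2 m × GaloisField 2 m,
    GaloisField 2 m × Bool, inferInstance, inferInstance, inferInstance, inferInstance,
    liftTwo h κ, liftTwoColour κ s i₁ i₂, ?_, ?_, ?_, liftTwo_injective hi h0,
    liftTwo_ne_zero h0, colouredCovers_liftTwo (hcov.refine hκ) hs hs₁ hs₂ h₃ h₁₂,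
    liftTwo_triple h0 hs₁ h₃⟩
  · rw [Nat.card_sum, Nat.card_prod, Nat.card_units, hK]
  · rw [Nat.card_prod, Nat.card_prod, hV, hK]
    ring
  · rw [Nat.card_prod, hK, pow_succ]
    simp

lemma hasTwoColumns_51 : HasTwoColumns 51 10 (2 ^ 4) := by
  refine ⟨{p // p ∈ colouredColumns columns51}, BinVec 10, Fin 16, inferInstance, inferInstance,
    inferInstance, inferInstance, fun p => bitVec 10 p.1.2,
    fun p => ⟨p.1.1, fst_lt_of_mem_colouredColumns p.2⟩,
    natCard_colouredColumns columns51_nodup, by simp [Nat.card_eq_fintype_card, ZMod.card],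
    by simp, bitVec_snd_injective columns51_lt columns51_nodup,
    bitVec_snd_ne_zero columns51_lt columns51_ne_zero,
    (colouredCovers_of_isFull columns51_lt isFull_columns51).refine
      fun i j h => congrArg Fin.val h, ⟨(2, 111), by decide⟩, ⟨(8, 274), by decide⟩,
      ⟨(12, 381), by decide⟩, ?_, by decide⟩
  exact (bitVec_xor 10 111 274).symm

/-- Lengthening a code of the family: its length is `52 * 2 ^ s - 1`. -/
lemma HasTwoColumns.lift_family {s e m : ℕ}
    (H : HasTwoColumns (52 * 2 ^ s - 1) (10 + 2 * s) (2 ^ e))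
    (hm : m ≠ 0) (he : e ≤ m) (hms : m ≤ s + 5) :
    HasTwoColumns (52 * 2 ^ (s + m) - 1) (10 + 2 * (s + m)) (2 ^ (m + 1)) := by
  have h1 : 2 ^ m ≤ 32 * 2 ^ s :=
    (Nat.pow_le_pow_right (by norm_num) hms).trans_eq (by rw [pow_add]; ring)
  have hs : 0 < 2 ^ s := by positivity
  have hm' : 0 < 2 ^ m := by positivity
  have := H.lift hm (Nat.pow_le_pow_right (by norm_num) he) (by omega)
  have h2 : (52 * 2 ^ s - 1) * 2 ^ m + (2 ^ m - 1) = 52 * 2 ^ (s + m) - 1 := by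
    rw [pow_add, Nat.sub_mul, ← mul_assoc]
    have : 1 * 2 ^ m ≤ 52 * 2 ^ s * 2 ^ m := Nat.mul_le_mul_right _ (by omega)
    omega
  rw [h2] at this
  convert this using 1
  ring

/-- For `15 ≤ s` there are few enough colours to lengthen to every `s'` with
`2 * s ≤ s' ≤ 2 * s + 1`. -/
lemma hasTwoColumns_large (s : ℕ) (hs : 15 ≤ s) :
    HasTwoColumns (52 * 2 ^ s - 1) (10 + 2 * s) (2 ^ (s - 8)) := by
  have h0 : HasTwoColumns (52 * 2 ^ 0 - 1) (10 + 2 * 0) (2 ^ 4) := hasTwoColumns_51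
  have h4 := h0.lift_family (m := 4) (by norm_num) (by norm_num) (by norm_num)
  induction s using Nat.strong_induction_on with
  | _ s ih =>
    have hstep : ∀ s₀ e, HasTwoColumns (52 * 2 ^ s₀ - 1) (10 + 2 * s₀) (2 ^ e) → 9 ≤ s₀ →
        s₀ + e ≤ s → s₀ < s → s ≤ 2 * s₀ + 5 →
        HasTwoColumns (52 * 2 ^ s - 1) (10 + 2 * s) (2 ^ (s - 8)) := by
      intro s₀ e H h9 h1 h2 h3
      have := H.lift_family (m := s - s₀) (by omega) (by omega) (by omega)
      rw [Nat.add_sub_cancel' h2.le] at this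
      exact this.mono (Nat.pow_le_pow_right (by norm_num) (by omega))
    rcases lt_or_ge s 24 with h24 | h24
    · exact hstep 9 6 (h4.lift_family (m := 5) (by norm_num) (by norm_num) (by norm_num))
        (by omega) (by omega) (by omega) (by omega)
    rcases lt_or_ge s 26 with h26 | h26
    · exact hstep 10 7 (h4.lift_family (m := 6) (by norm_num) (by norm_num) (by norm_num))
        (by omega) (by omega) (by omega) (by omega)
    rcases lt_or_ge s 30 with h30 | h30
    · exact hstep 15 _ (ih 15 (by omega) (by omega)) (by omega) (by omega) (by omega) (by omega)
    · exact hstep (s / 2) _ (ih (s / 2) (by omega) (by omega)) (by omega) (by omega) (by omega)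
        (by omega)

theorem hasTwoColumns_family (s : ℕ) (hs : s = 0 ∨ s = 4 ∨ s = 5 ∨ 9 ≤ s) :
    ∃ p, HasTwoColumns (52 * 2 ^ s - 1) (10 + 2 * s) p := by
  have h0 : HasTwoColumns (52 * 2 ^ 0 - 1) (10 + 2 * 0) (2 ^ 4) := hasTwoColumns_51
  have h4 := h0.lift_family (m := 4) (by norm_num) (by norm_num) (by norm_num)
  have h5 := h0.lift_family (m := 5) (by norm_num) (by norm_num) (by norm_num)
  rcases hs with rfl | rfl | rfl | hs
  · exact ⟨_, h0⟩
  · exact ⟨_, h4⟩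
  · exact ⟨_, h5⟩
  rcases lt_or_ge s 14 with h14 | h14
  · have := h4.lift_family (m := s - 4) (by omega) (by omega) (by omega)
    rw [show 0 + 4 + (s - 4) = s by omega] at this
    exact ⟨_, this⟩
  rcases lt_or_ge s 15 with h15 | h15
  · obtain rfl : s = 14 := by omega
    exact ⟨_, h5.lift_family (m := 9) (by norm_num) (by norm_num) (by norm_num)⟩
  · exact ⟨_, hasTwoColumns_large s h15⟩

/-! ### The families of covering radius `3` and `4` -/

/-- There are `n` columns in a space of dimension `r` over the field with two elements, whose
sums of at most `R` terms fill the space, and that belong to a code of minimum distance `3`. -/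
def HasCoveringColumns (n r R : ℕ) : Prop :=
  ∃ (ι V : Type) (_ : Finite ι) (_ : AddCommGroup V) (_ : Module (ZMod 2) V) (h : ι → V),
    Nat.card ι = n ∧ Nat.card V = 2 ^ r ∧ IsDistanceThree h ∧ Covers h R

lemma HasTwoColumns.hasCoveringColumns {n r p : ℕ} (H : HasTwoColumns n r p) :
    HasCoveringColumns n r 2 := by
  obtain ⟨ι, V, C, _, _, _, _, h, κ, h1, h2, -, h3, h4, h5, i, j, k, h6, -⟩ := H
  exact ⟨ι, V, ‹_›, ‹_›, ‹_›, h, h1, h2, ⟨h3, h4, i, j, k, h6⟩, h5.covers⟩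

lemma HasColumns.hasCoveringColumns {n r ℓ R p : ℕ} (H : HasColumns n r ℓ R p) :
    HasCoveringColumns n r R := by
  obtain ⟨ι, V, C, _, _, _, _, h, κ, h1, h2, -, h3, h4⟩ := H
  exact ⟨ι, V, ‹_›, ‹_›, ‹_›, h, h1, h2, h3, h4.covers⟩

lemma exists_injective_of_natCard_le {C K : Type*} [Finite C] [Finite K]
    (h : Nat.card C ≤ Nat.card K) : ∃ f : C → K, Function.Injective f :=
  ⟨_, (Finite.equivFin K).symm.injective.comp
    ((Fin.castLE_injective h).comp (Finite.equivFin C).injective)⟩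

theorem HasColumns.liftThree {n r m p : ℕ} (H : HasColumns n r 2 3 p) (hm : 2 ≤ m)
    (hp : p ≤ 2 ^ m) : HasCoveringColumns (n * 2 ^ m + (2 ^ m - 1)) (r + 3 * m) 3 := by
  obtain ⟨ι, V, C, _, _, _, _, h, κ, rfl, hV, hC, h3, hcov⟩ := H
  have hK : Nat.card (GaloisField 2 m) = 2 ^ m := GaloisField.card 2 m (by omega)
  have : Finite (GaloisField 2 m) := Nat.finite_of_card_ne_zero (by rw [hK]; positivity)
  have hK2 : 2 < Nat.card (GaloisField 2 m) := by
    have := Nat.pow_le_pow_right (n := 2) (by norm_num) hm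
    omega
  obtain ⟨f, hf⟩ := exists_injective_of_natCard_le (K := GaloisField 2 m) (hK ▸ hC.trans hp)
  refine ⟨(ι × GaloisField 2 m) ⊕ (GaloisField 2 m)ˣ,
    V × GaloisField 2 m × GaloisField 2 m × GaloisField 2 m, inferInstance, inferInstance,
    inferInstance, _root_.liftThree h (f ∘ κ), ?_, ?_,
    isDistanceThree_liftThree hK2 h3.injective h3.ne_zero,
    covers_liftThree (hcov.refine fun i j hij => hf hij)⟩
  · rw [Nat.card_sum, Nat.card_prod, Nat.card_units, hK]
  · rw [Nat.card_prod, Nat.card_prod, Nat.card_prod, hV, hK]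
    ring

theorem HasColumns.liftFour {n r m p : ℕ} (H : HasColumns n r 3 4 p) (hm : 2 ≤ m)
    (hp : p ≤ 2 ^ m) : HasCoveringColumns (n * 2 ^ m + (2 ^ m - 1)) (r + 4 * m) 4 := by
  obtain ⟨ι, V, C, _, _, _, _, h, κ, rfl, hV, hC, h3, hcov⟩ := H
  have hK : Nat.card (GaloisField 2 m) = 2 ^ m := GaloisField.card 2 m (by omega)
  have : Finite (GaloisField 2 m) := Nat.finite_of_card_ne_zero (by rw [hK]; positivity)
  have hK2 : 2 < Nat.card (GaloisField 2 m) := by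
    have := Nat.pow_le_pow_right (n := 2) (by norm_num) hm
    omega
  obtain ⟨f, hf⟩ := exists_injective_of_natCard_le (K := GaloisField 2 m) (hK ▸ hC.trans hp)
  refine ⟨(ι × GaloisField 2 m) ⊕ (GaloisField 2 m)ˣ,
    V × GaloisField 2 m × GaloisField 2 m × GaloisField 2 m × GaloisField 2 m, inferInstance,
    inferInstance, inferInstance, _root_.liftFour h (f ∘ κ), ?_, ?_,
    isDistanceThree_liftFour hK2 h3.injective h3.ne_zero,
    covers_liftFour (hcov.refine fun i j hij => hf hij)⟩
  · rw [Nat.card_sum, Nat.card_prod, Nat.card_units, hK]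
  · rw [Nat.card_prod, Nat.card_prod, Nat.card_prod, Nat.card_prod, hV, hK]
    ring

theorem hasCoveringColumns_three (m : ℕ) (hm : m = 0 ∨ 6 ≤ m) :
    HasCoveringColumns (819 * 2 ^ m - 1) (26 + 3 * m) 3 := by
  rcases hm with rfl | hm
  · exact hasColumns_818.hasCoveringColumns
  · have := hasColumns_818.liftThree (m := m) (by omega)
      (Nat.pow_le_pow_right (n := 2) (by norm_num) hm)
    rwa [show 818 * 2 ^ m + (2 ^ m - 1) = 819 * 2 ^ m - 1 by
      have : 0 < 2 ^ m := by positivity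
      omega] at this

theorem hasCoveringColumns_four (m : ℕ) (hm : m = 0 ∨ 7 ≤ m) :
    HasCoveringColumns (2943 * 2 ^ m - 1) (40 + 4 * m) 4 := by
  rcases hm with rfl | hm
  · exact hasColumns_2942.hasCoveringColumns
  · have := hasColumns_2942.liftFour (m := m) (by omega)
      (Nat.pow_le_pow_right (n := 2) (by norm_num) hm)
    rwa [show 2942 * 2 ^ m + (2 ^ m - 1) = 2943 * 2 ^ m - 1 by
      have : 0 < 2 ^ m := by positivity
      omega] at this

/-! ### From column systems to codes -/

section ColumnCode

variable {n : ℕ} {V : Type*} [AddCommGroup V] [Module (ZMod 2) V] {h : Fin n → V}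

/-- The code that has the vectors `h i` as columns of a parity-check matrix. -/
abbrev columnCode (h : Fin n → V) : BinCode :=
  ⟨n, LinearMap.ker (Fintype.linearCombination (ZMod 2) h)⟩

lemma linearCombination_eq_sum_support (x : BinVec n) :
    Fintype.linearCombination (ZMod 2) h x = ∑ i with x i ≠ 0, h i := by
  rw [Fintype.linearCombination_apply, Finset.sum_filter]
  refine Finset.sum_congr rfl fun i _ => ?_
  have : ∀ a : ZMod 2, a = 0 ∨ a = 1 := by decide
  rcases this (x i) with hx | hx <;> simp [hx]

lemma exists_hammingNorm_le {R : ℕ} (hc : Covers h R) (v : V) :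
    ∃ x : BinVec n, hammingNorm x ≤ R ∧ Fintype.linearCombination (ZMod 2) h x = v := by
  obtain ⟨l, hl, rfl⟩ := hc v
  suffices H : ∃ x : BinVec n, hammingNorm x ≤ l.length ∧
      Fintype.linearCombination (ZMod 2) h x = (l.map h).sum by
    obtain ⟨x, h1, h2⟩ := H
    exact ⟨x, h1.trans hl, h2⟩
  clear hl
  induction l with
  | nil => exact ⟨0, by simp, by simp⟩
  | cons i l ih =>
    obtain ⟨x, h1, h2⟩ := ih
    refine ⟨Pi.single i 1 + x, ?_, ?_⟩
    · have h3 : (Finset.univ.filter fun j => (Pi.single i 1 + x : BinVec n) j ≠ 0) ⊆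
          insert i (Finset.univ.filter fun j => x j ≠ 0) := by
        intro j hj
        by_cases hji : j = i
        · simp [hji]
        · simpa [hji] using hj
      exact (Finset.card_le_card h3).trans ((Finset.card_insert_le _ _).trans
        (Nat.succ_le_succ h1))
    · rw [map_add, h2, Fintype.linearCombination_apply_single, one_smul, List.map_cons,
        List.sum_cons]

lemma distTo_columnCode_le_iff {R : ℕ} (v : BinVec n) : (columnCode h).distTo v ≤ R ↔
    ∃ x : BinVec n, hammingNorm x ≤ R ∧ Fintype.linearCombination (ZMod 2) h x =
      Fintype.linearCombination (ZMod 2) h v := by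
  constructor
  · intro H
    obtain ⟨c, hc, hd⟩ := Nat.sInf_mem (s := {d : ℕ | ∃ c ∈ (columnCode h).2, hammingDist v c = d})
      ⟨_, 0, zero_mem _, rfl⟩
    refine ⟨-c + v, ?_, ?_⟩
    · rw [← hammingDist_eq_hammingNorm, hammingDist_comm, hd]
      exact H
    · rw [map_add, map_neg, LinearMap.mem_ker.1 hc, neg_zero, zero_add]
  · rintro ⟨x, hx, hxv⟩
    have hmem : v - x ∈ (columnCode h).2 := LinearMap.mem_ker.2 (by rw [map_sub, hxv, sub_self])
    have hle : (columnCode h).distTo v ≤ hammingDist v (v - x) := Nat.sInf_le ⟨_, hmem, rfl⟩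
    refine hle.trans ?_
    rwa [hammingDist_comm, hammingDist_eq_hammingNorm, neg_sub, sub_add_cancel]

theorem hasMinDist_columnCode (h3 : IsDistanceThree h) : (columnCode h).HasMinDist 3 := by
  classical
  have hself : ∀ v : V, v + v = 0 := fun v => by
    rw [← two_smul (ZMod 2) v, show (2 : ZMod 2) = 0 by decide, zero_smul]
  constructor
  · obtain ⟨i, j, k, hijk⟩ := h3.triple
    have hij : i ≠ j := by
      rintro rfl
      exact h3.ne_zero k (hijk ▸ hself _)
    have hik : i ≠ k := by
      rintro rfl
      exact h3.ne_zero j (by simpa using hijk)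
    have hjk : j ≠ k := by
      rintro rfl
      exact h3.ne_zero i (by simpa using hijk)
    let x : BinVec n := fun a => if a ∈ ({i, j, k} : Finset (Fin n)) then 1 else 0
    have hx : (Finset.univ.filter fun a => x a ≠ 0) = {i, j, k} := by
      ext a
      simp only [x, Finset.mem_filter, Finset.mem_univ, true_and]
      split_ifs with ha <;> simp [ha]
    have hx3 : hammingNorm x = 3 := by
      rw [hammingNorm, hx, Finset.card_eq_three]
      exact ⟨i, j, k, hij, hik, hjk, rfl⟩
    refine ⟨x, ?_, 0, zero_mem _, ?_, by rwa [hammingDist_zero_right]⟩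
    · refine LinearMap.mem_ker.2 ?_
      rw [linearCombination_eq_sum_support, hx, Finset.sum_insert (by simp [hij, hik]),
        Finset.sum_pair hjk, ← add_assoc, hijk, hself]
    · intro h0
      rw [h0, hammingNorm_zero] at hx3
      omega
  · rintro e ⟨c, hc, c', hc', hne, rfl⟩
    have h0 : Fintype.linearCombination (ZMod 2) h (-c + c') = 0 := by
      rw [map_add, map_neg, LinearMap.mem_ker.1 hc, LinearMap.mem_ker.1 hc', neg_zero, zero_add]
    rw [linearCombination_eq_sum_support] at h0
    rw [hammingDist_eq_hammingNorm]
    have h1 : hammingNorm (-c + c') ≠ 0 := by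
      rwa [hammingNorm_ne_zero_iff, ne_eq, neg_add_eq_zero]
    by_contra hlt
    have h12 : hammingNorm (-c + c') = 1 ∨ hammingNorm (-c + c') = 2 := by omega
    rw [hammingNorm] at h12
    rcases h12 with h1 | h2
    · obtain ⟨i, hi⟩ := Finset.card_eq_one.1 h1
      rw [hi, Finset.sum_singleton] at h0
      exact h3.ne_zero i h0
    · obtain ⟨i, j, hij, hi⟩ := Finset.card_eq_two.1 h2
      rw [hi, Finset.sum_pair hij] at h0
      refine hij (h3.injective ?_)
      rw [← add_right_cancel_iff (a := h j), h0, hself]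

/-- Fewer than `R` columns do not suffice when a ball of radius `R - 1` has less than `2 ^ r`
elements, so the covering radius is exactly `R`. -/
theorem isCoveringCode_columnCode {r R : ℕ} (hV : Nat.card V = 2 ^ r) (hc : Covers h R)
    (hball : ∑ i ∈ Finset.range R, n.choose i < 2 ^ r) :
    (columnCode h).IsCoveringCode n r R := by
  classical
  have hfin : Finite V := Nat.finite_of_card_ne_zero (by rw [hV]; positivity)
  have : Fintype V := Fintype.ofFinite V
  have hsurj : Function.Surjective (Fintype.linearCombination (ZMod 2) h) := fun v =>
    (exists_hammingNorm_le hc v).imp fun x hx => hx.2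
  refine ⟨rfl, ?_, le_antisymm (Finset.sup_le fun v _ => ?_) ?_⟩
  · have h1 := LinearMap.finrank_range_add_finrank_ker (Fintype.linearCombination (ZMod 2) h)
    have h2 : Module.finrank (ZMod 2) V = r := by
      have := Module.card_eq_pow_finrank (K := ZMod 2) (V := V)
      rw [← Nat.card_eq_fintype_card, hV, ZMod.card] at this
      exact (Nat.pow_right_injective le_rfl this).symm
    rw [LinearMap.range_eq_top.2 hsurj, finrank_top, h2, Module.finrank_fin_fun] at h1
    rw [add_comm]
    exact h1
  · exact (distTo_columnCode_le_iff v).2 (exists_hammingNorm_le hc _)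
  · by_contra hlt
    rw [not_le] at hlt
    refine hball.not_ge ?_
    have hcov : (Finset.univ : Finset V) ⊆
        ((Finset.range R).biUnion fun i => Finset.powersetCard i Finset.univ).image
          fun s => ∑ i ∈ s, h i := by
      intro v _
      obtain ⟨y, rfl⟩ := hsurj v
      obtain ⟨x, hx, hxy⟩ := (distTo_columnCode_le_iff (h := h) y).1 (Finset.le_sup
        (f := fun v : BinVec n => (columnCode h).distTo v) (Finset.mem_univ y))
      refine Finset.mem_image.2 ⟨Finset.univ.filter fun i => x i ≠ 0, ?_, ?_⟩
      · exact Finset.mem_biUnion.2 ⟨hammingNorm x, Finset.mem_range.2 (hx.trans_lt hlt),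
          Finset.mem_powersetCard.2 ⟨Finset.subset_univ _, rfl⟩⟩
      · rw [← linearCombination_eq_sum_support, hxy]
    calc 2 ^ r = (Finset.univ : Finset V).card := by
          rw [Finset.card_univ, ← Nat.card_eq_fintype_card, hV]
      _ ≤ _ := Finset.card_le_card hcov
      _ ≤ _ := Finset.card_image_le
      _ ≤ _ := Finset.card_biUnion_le
      _ = _ := by simp

end ColumnCode

lemma sum_choose_le_pow (n R : ℕ) : ∑ i ∈ Finset.range (R + 1), n.choose i ≤ (n + 1) ^ R := by
  rw [add_pow]
  refine Finset.sum_le_sum fun i hi => ?_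
  have hR : 0 < R.choose i := Nat.choose_pos (by simpa [Nat.lt_succ_iff] using hi)
  rw [one_pow, mul_one]
  exact (Nat.choose_le_pow n i).trans (Nat.le_mul_of_pos_right _ hR)

theorem HasCoveringColumns.exists_code {n r R : ℕ} (H : HasCoveringColumns n r (R + 1))
    (hn : (n + 1) ^ R < 2 ^ r) :
    ∃ C : BinCode, C.IsCoveringCode n r (R + 1) ∧ C.HasMinDist 3 := by
  obtain ⟨ι, V, _, _, _, h, rfl, hV, h3, hc⟩ := H
  let e := Finite.equivFin ι
  have h3' : IsDistanceThree (h ∘ e.symm) := by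
    obtain ⟨i, j, k, hijk⟩ := h3.triple
    exact ⟨h3.injective.comp e.symm.injective, fun i => h3.ne_zero _, e i, e j, e k, by simpa⟩
  have hc' : Covers (h ∘ e.symm) (R + 1) := fun v => by
    obtain ⟨l, hl, rfl⟩ := hc v
    exact ⟨l.map e, by simpa, by simp [Function.comp_def]⟩
  exact ⟨_, isCoveringCode_columnCode hV hc' ((sum_choose_le_pow _ _).trans_lt hn),
    hasMinDist_columnCode h3'⟩

/-! ### Asymptotic density -/

lemma tendsto_sum_choose_div_pow (R : ℕ) :
    Tendsto (fun n : ℕ => (∑ i ∈ Finset.range (R + 1), (n.choose i : ℝ)) / (n + 1) ^ R) atTop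
      (nhds (1 / R.factorial)) := by
  have hquot : Tendsto (fun n : ℕ => (n : ℝ) / (n + 1)) atTop (nhds 1) :=
    tendsto_natCast_div_add_atTop 1
  have hterm : ∀ i ∈ Finset.range (R + 1), Tendsto (fun n : ℕ => (n.choose i : ℝ) / (n + 1) ^ R)
      atTop (nhds (if i = R then 1 / (R.factorial : ℝ) else 0)) := by
    intro i hi
    have h1 : Tendsto (fun n : ℕ => (n.choose i : ℝ) / (n ^ i / i.factorial)) atTop (nhds 1) := by
      refine (Asymptotics.isEquivalent_iff_tendsto_one ?_).1 (isEquivalent_choose i)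
      filter_upwards [eventually_gt_atTop 0] with n hn
      positivity
    have h2 : Tendsto (fun n : ℕ => (1 / ((n : ℝ) + 1)) ^ (R - i)) atTop
        (nhds (if i = R then 1 else 0)) := by
      split_ifs with h
      · simp [h]
      · have h3 := (tendsto_one_div_add_atTop_nhds_zero_nat (𝕜 := ℝ)).pow (R - i)
        have hiR := Finset.mem_range.1 hi
        rwa [zero_pow (by omega)] at h3
    have h4 := ((h1.mul (hquot.pow i)).mul h2).div_const (i.factorial : ℝ)
    have h5 : (1 * 1 ^ i * (if i = R then 1 else 0)) / (i.factorial : ℝ) =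
        if i = R then 1 / (R.factorial : ℝ) else 0 := by
      split_ifs with h <;> simp [h]
    rw [h5] at h4
    refine h4.congr' ?_
    filter_upwards [eventually_gt_atTop 0] with n hn
    have hn' : (n : ℝ) ≠ 0 := by positivity
    have hn1 : (n : ℝ) + 1 ≠ 0 := by positivity
    have hi' : (i.factorial : ℝ) ≠ 0 := by positivity
    have hiR : i + (R - i) = R := by
      have := Finset.mem_range.1 hi
      omega
    conv_rhs => rw [← hiR, pow_add]
    rw [div_pow, div_pow, one_pow]
    field_simp
  have hsum := tendsto_finsetSum _ hterm
  rw [Finset.sum_ite_eq' (Finset.range (R + 1)) R, if_pos (by simp)] at hsum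
  exact hsum.congr fun n => (Finset.sum_div ..).symm

/-- Let the codes `C t` have lengths `n t`, codimensions `r t` and covering radius `R`, where
`(n t + 1) ^ R / 2 ^ r t` does not depend on `t`. Then this ratio divided by `R!` is the
asymptotic density. -/
theorem asymptoticDensity_image {T : Set ℕ} {C : ℕ → BinCode} {n r : ℕ → ℕ} {R : ℕ} {D : ℝ}
    (hC : ∀ t ∈ T, (C t).IsCoveringCode (n t) (r t) R)
    (hD : ∀ t ∈ T, ((n t : ℝ) + 1) ^ R = D * 2 ^ r t) (hT : ∀ᶠ t in atTop, t ∈ T)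
    (hn : Tendsto n atTop atTop) :
    asymptoticDensity (C '' T) = ((D / R.factorial : ℝ) : EReal) := by
  have hne : (comap BinCode.length atTop ⊓ 𝓟 (C '' T)).NeBot := by
    have h1 : Tendsto C atTop (comap BinCode.length atTop ⊓ 𝓟 (C '' T)) := by
      refine tendsto_inf.2 ⟨tendsto_comap_iff.2 ?_, tendsto_principal.2 ?_⟩
      · refine hn.congr' ?_
        filter_upwards [hT] with t ht
        exact (hC t ht).1.symm
      · filter_upwards [hT] with t ht
        exact Set.mem_image_of_mem C ht
    exact h1.neBot
  have hlen : Tendsto BinCode.length (comap BinCode.length atTop ⊓ 𝓟 (C '' T)) atTop :=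
    tendsto_comap.mono_left inf_le_left
  have hlim : Tendsto BinCode.density (comap BinCode.length atTop ⊓ 𝓟 (C '' T))
      (nhds (D / R.factorial)) := by
    have h1 := ((tendsto_sum_choose_div_pow R).comp hlen).const_mul D
    rw [mul_one_div] at h1
    refine h1.congr' ?_
    filter_upwards [mem_inf_of_right (mem_principal_self (C '' T))]
    rintro _ ⟨t, ht, rfl⟩
    obtain ⟨h2, h3, h4⟩ := hC t ht
    have h5 : (2 : ℝ) ^ (C t).length = 2 ^ (C t).dim * 2 ^ r t := by rw [h2, ← h3, pow_add]
    have h6 : D * 2 ^ r t ≠ 0 := by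
      rw [← hD t ht]
      positivity
    have h7 : D ≠ 0 := left_ne_zero_of_mul h6
    rw [Function.comp_apply, BinCode.density, h5, h4, h2, hD t ht]
    field_simp
  exact ((continuous_coe_real_ereal.tendsto _).comp hlim).liminf_eq

/-! ### The three families -/

theorem exists_code_two {t : ℕ} (ht : t ∈ index2) : ∃ C : BinCode,
    C.IsCoveringCode (26 * 2 ^ (t - 4) - 1) (2 * t) 2 ∧ C.HasMinDist 3 := by
  obtain ⟨r, rfl, hr⟩ := ht
  obtain ⟨s, rfl⟩ : ∃ s, t = s + 5 := ⟨t - 5, by omega⟩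
  obtain ⟨p, hp⟩ := hasTwoColumns_family s (by omega)
  have h1 : 26 * 2 ^ (s + 5 - 4) = 52 * 2 ^ s := by
    rw [show s + 5 - 4 = s + 1 by omega, pow_succ]
    ring
  have h2 : 2 ^ s ≤ 2 ^ (2 * s) := Nat.pow_le_pow_right (by norm_num) (by omega)
  have h3 : 0 < 2 ^ s := by positivity
  rw [h1, show 2 * (s + 5) = 10 + 2 * s by ring]
  refine hp.hasCoveringColumns.exists_code ?_
  rw [pow_one, pow_add]
  omega

theorem exists_code_three {t : ℕ} (ht : t ∈ index3) : ∃ C : BinCode,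
    C.IsCoveringCode (819 * 2 ^ (t - 9) - 1) (3 * t - 1) 3 ∧ C.HasMinDist 3 := by
  obtain ⟨r, h, hr⟩ := ht
  obtain ⟨m, rfl⟩ : ∃ m, t = m + 9 := ⟨t - 9, by omega⟩
  rw [Nat.add_sub_cancel, show 3 * (m + 9) - 1 = 26 + 3 * m by omega]
  refine (hasCoveringColumns_three m (by omega)).exists_code ?_
  have h3 : 0 < 2 ^ m := by positivity
  rw [Nat.sub_add_cancel (by omega), mul_pow, ← pow_mul, pow_add]
  have h2 : 2 ^ (m * 2) ≤ 2 ^ (3 * m) := Nat.pow_le_pow_right (by norm_num) (by omega)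
  have h4 : 0 < 2 ^ (m * 2) := by positivity
  omega

theorem exists_code_four {t : ℕ} (ht : t ∈ index4) : ∃ C : BinCode,
    C.IsCoveringCode (2943 * 2 ^ (t - 10) - 1) (4 * t) 4 ∧ C.HasMinDist 3 := by
  obtain ⟨r, h, hr⟩ := ht
  obtain ⟨m, rfl⟩ : ∃ m, t = m + 10 := ⟨t - 10, by omega⟩
  rw [Nat.add_sub_cancel, show 4 * (m + 10) = 40 + 4 * m by ring]
  refine (hasCoveringColumns_four m (by omega)).exists_code ?_
  have h3 : 0 < 2 ^ m := by positivity
  rw [Nat.sub_add_cancel (by omega), mul_pow, ← pow_mul, pow_add]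
  have h2 : 2 ^ (m * 3) ≤ 2 ^ (4 * m) := Nat.pow_le_pow_right (by norm_num) (by omega)
  have h4 : 0 < 2 ^ (m * 3) := by positivity
  omega

/-- A family of codes, one for each `t ∈ T`, together with its asymptotic density. -/
lemma exists_family {T : Set ℕ} {a k R : ℕ} {r : ℕ → ℕ} {D : ℝ} (ha : 0 < a)
    (H : ∀ t ∈ T, ∃ C : BinCode, C.IsCoveringCode (a * 2 ^ (t - k) - 1) (r t) R ∧ C.HasMinDist 3)
    (hT : ∀ᶠ t in atTop, t ∈ T)
    (hD : ∀ t ∈ T, (a * 2 ^ (t - k) : ℝ) ^ R = D * R.factorial * 2 ^ r t) :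
    ∃ C : ℕ → BinCode, (∀ t ∈ T, (C t).IsCoveringCode (a * 2 ^ (t - k) - 1) (r t) R ∧
      (C t).HasMinDist 3) ∧ asymptoticDensity (C '' T) = (D : EReal) := by
  classical
  choose! C hC using H
  refine ⟨C, hC, ?_⟩
  have hR : (R.factorial : ℝ) ≠ 0 := by positivity
  rw [asymptoticDensity_image (D := D * R.factorial) (fun t ht => (hC t ht).1) ?_ hT ?_,
    mul_div_cancel_right₀ _ hR]
  · intro t ht
    have : 0 < a * 2 ^ (t - k) := by positivity
    rw [← hD t ht, Nat.cast_sub this]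
    push_cast
    ring
  · refine tendsto_atTop_mono (f := fun t => t - (k + 1)) (fun t => ?_) (tendsto_sub_atTop_nat _)
    have h1 : t - k < 2 ^ (t - k) := Nat.lt_two_pow_self
    have h2 : 2 ^ (t - k) ≤ a * 2 ^ (t - k) := Nat.le_mul_of_pos_left _ ha
    omega

lemma lengthFunction_le {n r R : ℕ} (H : ∃ C : BinCode, C.IsCoveringCode n r R ∧ C.HasMinDist 3) :
    lengthFunction r R ≤ n :=
  Nat.sInf_le (H.imp fun _ h => h.1)

theorem theorem2p1 :
    -- `R = 2`, `r = 2t`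
    (∃ C : ℕ → BinCode,
      (∀ t ∈ index2, (C t).IsCoveringCode (26 * 2 ^ (t - 4) - 1) (2 * t) 2 ∧
        (C t).HasMinDist 3) ∧
      asymptoticDensity (C '' index2) = ((26 ^ 2 / 2 ^ 9 : ℝ) : EReal)) ∧
    |(26 ^ 2 / 2 ^ 9 : ℝ) - 1.3203| < 0.00005 ∧
    (∀ r t : ℕ, r = 2 * t → t ∈ index2 →
      lengthFunction r 2 ≤ 26 * 2 ^ (t - 4) - 1 ∧
      26 * 2 ^ (r / 2 - 4) - 1 = 26 * 2 ^ (t - 4) - 1 ∧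
      priorBound2 r - (26 * 2 ^ (t - 4) - 1) = 2 ^ (r / 2 - 4)) ∧
    -- `R = 3`, `r = 3t - 1`
    (∃ C : ℕ → BinCode,
      (∀ t ∈ index3, (C t).IsCoveringCode (819 * 2 ^ (t - 9) - 1) (3 * t - 1) 3 ∧
        (C t).HasMinDist 3) ∧
      asymptoticDensity (C '' index3) = ((819 ^ 3 / (6 * 2 ^ 26) : ℝ) : EReal)) ∧
    |(819 ^ 3 / (6 * 2 ^ 26) : ℝ) - 1.3643| < 0.00005 ∧
    (∀ r t : ℕ, r + 1 = 3 * t → t ∈ index3 →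
      lengthFunction r 3 ≤ 819 * 2 ^ (t - 9) - 1 ∧
      819 * 2 ^ ((r - 26) / 3) - 1 = 819 * 2 ^ (t - 9) - 1 ∧
      priorBound3 r - (819 * 2 ^ (t - 9) - 1) = 2 ^ ((r - 23) / 3)) ∧
    -- `R = 4`, `r = 4t`
    (∃ C : ℕ → BinCode,
      (∀ t ∈ index4, (C t).IsCoveringCode (2943 * 2 ^ (t - 10) - 1) (4 * t) 4 ∧
        (C t).HasMinDist 3) ∧
      asymptoticDensity (C '' index4) = ((2943 ^ 4 / (24 * 2 ^ 40) : ℝ) : EReal)) ∧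
    |(2943 ^ 4 / (24 * 2 ^ 40) : ℝ) - 2.8428| < 0.00005 ∧
    (∀ r t : ℕ, r = 4 * t → t ∈ index4 →
      lengthFunction r 4 ≤ 2943 * 2 ^ (t - 10) - 1 ∧
      2943 * 2 ^ (r / 4 - 10) - 1 = 2943 * 2 ^ (t - 10) - 1 ∧
      priorBound4 r - (2943 * 2 ^ (t - 10) - 1) = 2 ^ (r / 4 - 10) - 1) := by
  refine ⟨?_, ?_, ?_, ?_, ?_, ?_, ?_, ?_, ?_⟩
  · refine exists_family (by norm_num) (fun t => exists_code_two) ?_ ?_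
    · filter_upwards [eventually_ge_atTop 14] with t ht
      exact ⟨_, rfl, by omega⟩
    · rintro t ⟨r, rfl, hr⟩
      obtain ⟨s, rfl⟩ : ∃ s, t = s + 4 := ⟨t - 4, by omega⟩
      rw [Nat.add_sub_cancel, mul_pow, ← pow_mul, mul_add, pow_add, mul_comm s]
      norm_num [Nat.factorial]
      ring
  · norm_num [abs_lt]
  · rintro r t rfl ht
    have h : 2 * t / 2 = t := by omega
    refine ⟨lengthFunction_le (exists_code_two ht), by rw [h], ?_⟩
    rw [priorBound2, h]
    ring
  · refine exists_family (by norm_num) (fun t => exists_code_three) ?_ ?_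
    · filter_upwards [eventually_ge_atTop 15] with t ht
      exact ⟨3 * t - 1, by omega, by omega⟩
    · rintro t ⟨r, h, hr⟩
      obtain ⟨s, rfl⟩ : ∃ s, t = s + 9 := ⟨t - 9, by omega⟩
      rw [Nat.add_sub_cancel, mul_pow, ← pow_mul, show 3 * (s + 9) - 1 = 3 * s + 26 by omega,
        pow_add, mul_comm s]
      norm_num [Nat.factorial]
      ring
  · norm_num [abs_lt]
  · rintro r t hrt ht
    obtain ⟨r', h', hr'⟩ := id ht
    obtain rfl : r = r' := by omega
    obtain ⟨m, rfl⟩ : ∃ m, t = m + 9 := ⟨t - 9, by omega⟩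
    obtain rfl : r = 3 * (m + 9) - 1 := by omega
    have h1 : (3 * (m + 9) - 1 - 26) / 3 = m := by omega
    have h2 : (3 * (m + 9) - 1 - 23) / 3 = m + 1 := by omega
    refine ⟨lengthFunction_le (exists_code_three ht), by rw [h1, Nat.add_sub_cancel], ?_⟩
    rw [priorBound3, h1, h2, Nat.add_sub_cancel]
    rcases hr' with hr | hr
    · obtain rfl : m = 0 := by omega
      norm_num
    · rw [if_neg (by omega)]
      ring
  · refine exists_family (by norm_num) (fun t => exists_code_four) ?_ ?_
    · filter_upwards [eventually_ge_atTop 17] with t ht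
      exact ⟨_, rfl, by omega⟩
    · rintro t ⟨r, rfl, hr⟩
      obtain ⟨s, rfl⟩ : ∃ s, t = s + 10 := ⟨t - 10, by omega⟩
      rw [Nat.add_sub_cancel, mul_pow, ← pow_mul, mul_add, pow_add, mul_comm s]
      norm_num [Nat.factorial]
      ring
  · norm_num [abs_lt]
  · rintro r t rfl ht
    have h : 4 * t / 4 = t := by omega
    refine ⟨lengthFunction_le (exists_code_four ht), by rw [h], ?_⟩
    rw [priorBound4, h]
    ring
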